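/- Let $d\ge 1$. **Random walk.** Let $\mathbb D_0\subseteq\mathbb D_1\subseteq\dots$ be connected subgraphs of the nearest-neighbour graph $\mathbb Z^d$ with every $y\in\mathbb Z^d$ belonging to some $\mathbb D_t$ (e.g. induced subgraphs on connected sets $\mathbb D_t\uparrow\mathbb Z^d$). Let $\{X_t\}$ be, under $\mathbb P_x$, the discrete-time simple random walk started at $X_0=x\in\mathbb D_0$: given $X_0,\dots,X_t$, the position $X_{t+1}$ is uniform among the neighbours of $X_t$ in $\mathbb D_{t+1}$ (the walk stays put if there is none). For $x\in\mathbb D_0$, $y\in\mathbb Z^d$ put $q_{xy}=\mathbb P_x(X_t=y\text{ for infinitely many }t)$. Then 1. for each $x\in\mathbb D_0$, $q_{xy}$ does not depend on $y\in\mathbb Z^d$; 2. if $q_{zy}=0$ for some $z\in\mathbb D_0$ and $y\in\mathbb Z^d$, then $q_{xy}=0$ for all $x\in\mathbb D_0$ with $\|x-z\|_1$ even. **Reflected Brownian motion.** Let $(\mathbb D_t)_{t\ge0}$ be a non-decreasing family of subsets of $\mathbb R^d$ with $\bigcup_t\mathbb D_t=\mathbb R^d$ and $\mathbb D_0$ open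 and connected, and put $\mathcal D=\{(t,x):t\ge 0,\ x\in\mathbb D_t\}$. Let $U$ be a standard $d$-dimensional Brownian motion. Assume that the normally reflected Brownian motion on $\mathcal D$ driven by $U$ is well defined: for every $(s,x)\in\overline{\mathcal D}$ there is an (almost surely) unique pair of continuous processes $(W_t,L_t)_{t\ge s}$, adapted to the minimal admissible (right-continuous, augmented) filtration of $U$, with $L$ non-decreasing, such that for all $t\ge s$ one has $(t,W_t)\in\overline{\mathcal D}$, $$W_t=x+U_t-U_s+\int_s^t\mathbf n(u,W_u)\,dL_u,\qquad L_t=\int_s^t\mathbf 1_{\partial\mathcal D}(u,W_u)\,dL_u,$$ where $\mathbf n(u,y)$ is the inward unit normal to $\mathbb D_u$ at $y\in\partial\mathbb D_u$ (required to exist at $W_u$ for $dL$-almost every $u$); and these processes form a (time-inhomogeneous) strong Markov family. For $x\in\mathbb D_0$ let $X$ be the process $W$ started from $x$ at time $0$. For $y\in\mathbb R^d$ and $\epsilon>0$ put $\sigma^{(0)}_\epsilon=\inf\{t\ge0:\mathbb D_t\supseteq\mathbb B_\epsilon+x\}$, where $\mathbb B_\epsilon$ is the ball of radius $\epsilon$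 centred at $0$, and for $i\ge1$ $$\tau^{(i)}_\epsilon=\inf\{t\ge\sigma^{(i-1)}_\epsilon:|X_t-y|<\epsilon\},\qquad \sigma^{(i)}_\epsilon=\inf\{t\ge\tau^{(i)}_\epsilon:|X_t-y|>1/2\},$$ and let $q_{xy}$ be the probability that $\tau^{(i)}_\epsilon<\infty$ for all $i\ge 1$ and all $\epsilon>0$. Then 1. for each $x\in\mathbb D_0$, $q_{xy}$ does not depend on $y\in\mathbb R^d$; 2. if $q_{zy}\in\{0,1\}$ for some $z\in\mathbb D_0$ and $y\in\mathbb R^d$, then $q_{xy}=q_{zy}$ for all $x\in\mathbb D_0$. -/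

import Mathlib

open MeasureTheory ProbabilityTheory Set Filter Topology
open scoped NNReal ENNReal RealInnerProductSpace

noncomputable section

/-! ### Simple random walk on growing subgraphs of `ℤ^d` -/

/-- The `ℓ¹` norm on `ℤ^d`. -/
def l1Norm {d : ℕ} (v : Fin d → ℤ) : ℤ := ∑ i, |v i|

/-- The nearest neighbour graph `ℤ^d`: two sites are adjacent when their `ℓ¹` distance is one. -/
def latticeGraph (d : ℕ) : SimpleGraph (Fin d → ℤ) where
  Adj u v := l1Norm (u - v) = 1
  symm := ⟨fun u v h => by
    simp only [l1Norm, Pi.sub_apply] at h ⊢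
    simpa only [abs_sub_comm] using h⟩
  loopless := ⟨fun u h => by simp [l1Norm] at h⟩

open Classical in
/-- One-step transition probability from `u` to `v` in the graph `H`: uniform over the neighbours
of `u` in `H`. (If `u` has no neighbour in `H`, the walker stays put.) -/
def srwStep {d : ℕ} (H : (latticeGraph d).Subgraph) (u v : Fin d → ℤ) : ℝ≥0∞ :=
  if (H.neighborSet u).Nonempty then
    if H.Adj u v then ((H.neighborSet u).ncard : ℝ≥0∞)⁻¹ else 0
  else if v = u then 1 else 0

/-- Under `P`, the process `X` is the simple random walk on the growing graphs `D t`, started at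
`x`: being at `u` at time `n`, it chooses its position at time `n + 1` uniformly among the
neighbours of `u` in `D (n + 1)`, whatever its past. -/
structure IsSRW {d : ℕ} {Ω : Type*} [MeasurableSpace Ω] (D : ℕ → (latticeGraph d).Subgraph)
    (x : Fin d → ℤ) (X : ℕ → Ω → (Fin d → ℤ)) (P : Measure Ω) : Prop where
  isProbabilityMeasure : IsProbabilityMeasure P
  measurable : ∀ n, Measurable (X n)
  start : ∀ᵐ ω ∂P, X 0 ω = x
  step : ∀ (n : ℕ) (v : ℕ → (Fin d → ℤ)),
    P {ω | ∀ i ≤ n + 1, X i ω = v i}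
      = P {ω | ∀ i ≤ n, X i ω = v i} * srwStep (D (n + 1)) (v n) (v (n + 1))

/-- A path of the walk is `xy`-recurrent if it starts at `x` and visits `y` infinitely often. -/
def IsWalkRecurrent {d : ℕ} (x y : Fin d → ℤ) (w : ℕ → (Fin d → ℤ)) : Prop :=
  w 0 = x ∧ ∃ᶠ t in atTop, w t = y

/-! ### Recurrence of continuous-time paths in growing domains -/

/-- First time `t ≥ a` with `|w t - y| < ε`. -/
def hitTime {d : ℕ} (w : ℝ≥0 → EuclideanSpace ℝ (Fin d)) (y : EuclideanSpace ℝ (Fin d)) (ε : ℝ)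
    (a : ℝ≥0∞) : ℝ≥0∞ :=
  ⨅ (t : ℝ≥0) (_ : a ≤ t) (_ : ‖w t - y‖ < ε), (t : ℝ≥0∞)

/-- First time `t ≥ a` with `|w t - y| > 1/2`. -/
def leaveTime {d : ℕ} (w : ℝ≥0 → EuclideanSpace ℝ (Fin d)) (y : EuclideanSpace ℝ (Fin d))
    (a : ℝ≥0∞) : ℝ≥0∞ :=
  ⨅ (t : ℝ≥0) (_ : a ≤ t) (_ : 1 / 2 < ‖w t - y‖), (t : ℝ≥0∞)

/-- The times `σ⁽ⁱ⁾`: `σ⁽⁰⁾` is the first time at which `D t` contains the ball of radius `ε`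
around the starting point `x`, and `σ⁽ⁱ⁺¹⁾` is the first time after `τ⁽ⁱ⁺¹⁾` at which the path is
at distance more than `1/2` from `y`, where `τ⁽ⁱ⁺¹⁾ = hitTime w y ε σ⁽ⁱ⁾`. -/
def excursionEnd {d : ℕ} (D : ℝ≥0 → Set (EuclideanSpace ℝ (Fin d)))
    (x y : EuclideanSpace ℝ (Fin d)) (ε : ℝ) (w : ℝ≥0 → EuclideanSpace ℝ (Fin d)) : ℕ → ℝ≥0∞
  | 0 => ⨅ (t : ℝ≥0) (_ : Metric.ball x ε ⊆ D t), (t : ℝ≥0∞)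
  | i + 1 => leaveTime w y (hitTime w y ε (excursionEnd D x y ε w i))

/-- The path `w` is `xy`-recurrent: it starts at `x` and, for every `ε > 0`, makes infinitely many
excursions to the ball of radius `ε` around `y`, i.e. `τ⁽ⁱ⁾ < ∞` for all `i ≥ 1`. -/
def IsXYRecurrent {d : ℕ} (D : ℝ≥0 → Set (EuclideanSpace ℝ (Fin d)))
    (x y : EuclideanSpace ℝ (Fin d)) (w : ℝ≥0 → EuclideanSpace ℝ (Fin d)) : Prop :=
  w 0 = x ∧ ∀ ε : ℝ, 0 < ε → ∀ i : ℕ, hitTime w y ε (excursionEnd D x y ε w i) < ∞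

/-! ### Brownian motion and its filtration -/

/-- `U` is a standard Brownian motion in `ℝ^d`: its coordinates are independent standard
one-dimensional Brownian motions. -/
structure IsBrownianMotion {d : ℕ} {Ω : Type*} [MeasurableSpace Ω]
    (U : ℝ≥0 → Ω → EuclideanSpace ℝ (Fin d)) (P : Measure Ω) : Prop where
  measurable : ∀ t, Measurable (U t)
  coord : ∀ i : Fin d, IsBrownianReal (fun t ω => U t ω i) P
  indep : iIndepFun (fun (i : Fin d) (ω : Ω) (t : ℝ≥0) => U t ω i) P

/-- The minimal admissible filtration of the process `U`: the right-continuous filtration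
generated by `U` and the `P`-null events. -/
def minimalFiltration {d : ℕ} {Ω : Type*} [m : MeasurableSpace Ω]
    (U : ℝ≥0 → Ω → EuclideanSpace ℝ (Fin d)) (P : Measure Ω) : Filtration ℝ≥0 m :=
  Filtration.rightCont
    { seq := fun t =>
        eventuallyMeasurableSpace (⨆ s ≤ t, MeasurableSpace.comap (U s) inferInstance) (ae P) ⊓ m
      mono' := by
        intro a b hab
        refine inf_le_inf_right m ?_
        rintro s ⟨t, ht, hst⟩
        have hle : (⨆ s ≤ a, MeasurableSpace.comap (U s) inferInstance)
            ≤ ⨆ s ≤ b, MeasurableSpace.comap (U s) inferInstance :=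
          biSup_mono fun c hc => hc.trans hab
        exact ⟨t, hle t ht, hst⟩
      le' := fun _ => inf_le_right }

/-! ### Reflected Brownian motion on growing domains -/

/-- The time-space domain `{(t, x) : x ∈ D t}`. -/
def timeSpace {d : ℕ} (D : ℝ≥0 → Set (EuclideanSpace ℝ (Fin d))) :
    Set (ℝ≥0 × EuclideanSpace ℝ (Fin d)) :=
  {p | p.2 ∈ D p.1}

/-- `n` is the inward unit normal to the set `S` at its boundary point `y`: at small scales
around `y`, the set `S` is close to the half-space `{z : ⟪z - y, n⟫ > 0}`. -/
def IsInwardUnitNormal {d : ℕ} (S : Set (EuclideanSpace ℝ (Fin d)))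
    (y n : EuclideanSpace ℝ (Fin d)) : Prop :=
  y ∈ frontier S ∧ ‖n‖ = 1 ∧ ∀ ε : ℝ, 0 < ε → ∀ᶠ z in 𝓝 y,
    (ε * ‖z - y‖ < ⟪z - y, n⟫ → z ∈ S) ∧ (⟪z - y, n⟫ < -(ε * ‖z - y‖) → z ∉ S)

open Classical in
/-- The inward unit normal to `S` at `y` (zero when there is none). -/
def inwardNormal {d : ℕ} (S : Set (EuclideanSpace ℝ (Fin d))) (y : EuclideanSpace ℝ (Fin d)) :
    EuclideanSpace ℝ (Fin d) :=
  if h : ∃ n, IsInwardUnitNormal S y n then h.choose else 0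

open Classical in
/-- The Lebesgue-Stieltjes measure `dℓ` on `(s, ∞)` of a function `ℓ` that is continuous and
non-decreasing on `[s, ∞)`. -/
def stieltjesFrom (s : ℝ≥0) (ℓ : ℝ≥0 → ℝ) : Measure ℝ≥0 :=
  if h : Monotone (fun u => ℓ (max s u)) then h.stieltjesFunction.measure else 0

/-- The pair of paths `(w, ℓ)` solves on `[s, ∞)` the Skorokhod problem in the growing domain `D`
driven by the path `b`, with `w s = x`. -/
structure SolvesSkorokhod {d : ℕ} (D : ℝ≥0 → Set (EuclideanSpace ℝ (Fin d)))
    (b : ℝ≥0 → EuclideanSpace ℝ (Fin d)) (s : ℝ≥0) (x : EuclideanSpace ℝ (Fin d))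
    (w : ℝ≥0 → EuclideanSpace ℝ (Fin d)) (ℓ : ℝ≥0 → ℝ) : Prop where
  continuousOn_path : ContinuousOn w (Ici s)
  continuousOn_local : ContinuousOn ℓ (Ici s)
  monotoneOn_local : MonotoneOn ℓ (Ici s)
  mem_closure : ∀ t, s ≤ t → (t, w t) ∈ closure (timeSpace D)
  /-- the inward normal at `w u` exists for `dℓ`-almost every `u` -/
  normal : ∀ᵐ u ∂(stieltjesFrom s ℓ), IsInwardUnitNormal (D u) (w u) (inwardNormal (D u) (w u))
  integrable : ∀ t, s ≤ t →
    IntegrableOn (fun u => inwardNormal (D u) (w u)) (Ioc s t) (stieltjesFrom s ℓ)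
  /-- `w_t = x + b_t - b_s + ∫_s^t n(u, w_u) dℓ_u` -/
  path_eq : ∀ t, s ≤ t →
    w t = x + b t - b s + ∫ u in Ioc s t, inwardNormal (D u) (w u) ∂(stieltjesFrom s ℓ)
  /-- `ℓ_t = ∫_s^t 1_{(u, w_u) ∈ ∂𝒟} dℓ_u` -/
  local_eq : ∀ t, s ≤ t →
    ℓ t = (stieltjesFrom s ℓ).real (Ioc s t ∩ {u | (u, w u) ∈ frontier (timeSpace D)})

/-- `(W, L)` is a pair of processes, adapted to the minimal admissible filtration of `U`, which
almost surely solves the Skorokhod problem in the growing domain `D`, driven by `U` and started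
from `x` at time `s`. -/
structure IsReflectedSolution {d : ℕ} {Ω : Type*} [MeasurableSpace Ω]
    (D : ℝ≥0 → Set (EuclideanSpace ℝ (Fin d))) (U : ℝ≥0 → Ω → EuclideanSpace ℝ (Fin d))
    (P : Measure Ω) (s : ℝ≥0) (x : EuclideanSpace ℝ (Fin d))
    (W : ℝ≥0 → Ω → EuclideanSpace ℝ (Fin d)) (L : ℝ≥0 → Ω → ℝ) : Prop where
  adapted_path : ∀ t, s ≤ t → Measurable[minimalFiltration U P t] (W t)
  adapted_local : ∀ t, s ≤ t → Measurable[minimalFiltration U P t] (L t)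
  solves : ∀ᵐ ω ∂P, SolvesSkorokhod D (fun t => U t ω) s x (fun t => W t ω) (fun t => L t ω)

/-- Reflected Brownian motion on the growing domains `D` (RBMG). Here `W s x` is the process
started from `x` at time `s`, for `(s, x)` in the closure of the time-space domain, and `L s x` is
its boundary local time. The pair is the unique solution of the Skorokhod problem driven by the
Brownian motion `U`, and the processes `W s x` form a strong Markov family. -/
structure IsRBMG {d : ℕ} {Ω : Type*} [MeasurableSpace Ω]
    (D : ℝ≥0 → Set (EuclideanSpace ℝ (Fin d))) (U : ℝ≥0 → Ω → EuclideanSpace ℝ (Fin d))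
    (P : Measure Ω) (W : ℝ≥0 → EuclideanSpace ℝ (Fin d) → ℝ≥0 → Ω → EuclideanSpace ℝ (Fin d))
    (L : ℝ≥0 → EuclideanSpace ℝ (Fin d) → ℝ≥0 → Ω → ℝ) : Prop where
  monotone : Monotone D
  brownian : IsBrownianMotion U P
  solution : ∀ s x, (s, x) ∈ closure (timeSpace D) →
    IsReflectedSolution D U P s x (W s x) (L s x)
  unique : ∀ s x, (s, x) ∈ closure (timeSpace D) → ∀ W' L', IsReflectedSolution D U P s x W' L' →
    ∀ᵐ ω ∂P, ∀ t, s ≤ t → W' t ω = W s x t ω ∧ L' t ω = L s x t ω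
  /-- the transition probabilities depend measurably on the starting point in time-space -/
  measurable_transition : ∀ (r : ℝ≥0) (B : Set (EuclideanSpace ℝ (Fin d))), MeasurableSet B →
    Measurable fun p : closure (timeSpace D) => P {ω | W p.1.1 p.1.2 (p.1.1 + r) ω ∈ B}
  /-- the strong Markov property at a stopping time `τ ≥ s`, possibly infinite: on `{τ < ∞}`, given
  the past of `τ`, the probability that `W_{τ + r} ∈ B` is that of the process started from
  `W_τ` at time `τ` -/
  strong_markov : ∀ s x, (s, x) ∈ closure (timeSpace D) →
    ∀ (τ : Ω → WithTop ℝ≥0) (hτ : IsStoppingTime (minimalFiltration U P) τ),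
      (∀ ω, (s : WithTop ℝ≥0) ≤ τ ω) →
    ∀ A : Set Ω, MeasurableSet[hτ.measurableSpace] A →
    ∀ (r : ℝ≥0) (B : Set (EuclideanSpace ℝ (Fin d))), MeasurableSet B →
      P {ω | ω ∈ A ∧ τ ω ≠ ⊤ ∧ W s x ((τ ω).untopD 0 + r) ω ∈ B}
        = ∫⁻ ω in A ∩ {ω | τ ω ≠ ⊤},
            P {ω' | W ((τ ω).untopD 0) (W s x ((τ ω).untopD 0) ω)
              ((τ ω).untopD 0 + r) ω' ∈ B} ∂P

end

/-!
Both parts rest on one escape lemma, `measure_iInter_eq_zero_of_escape`: an event that survives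
infinitely many trials, each of which ends it with conditional probability at least `c > 0`, is
null.

*Random walk.* Any two sites are joined by a path of edges that are open from some time on. On
visiting one end of such an edge, the walk crosses it with probability at least the inverse degree
in the lattice, so infinitely many visits to one end almost surely entail infinitely many visits to
the other (`IsSRW.ae_frequently_of_adj`). Hence the recurrence events for different sites agree
almost surely. For the second claim let `x ≠ z` have the same parity. As no vertex is isolated, the
distance of a walk from its start has the parity of the time, and the walk from `z` is at `x` with
positive probability at every large even time `t` (`IsSRW.measure_ne_zero_of_even`). Given the
position at time `t`, the future has the same law for both walks (`IsSRW.measure_shift_mul`). If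
recurrence is null from `z`, then the walk from `x` is almost surely not both recurrent and at `x`
at such a time `t`. But a recurrent walk visits `x` infinitely often, always at even times.

*Reflected Brownian motion.* If the domains do not exhaust the space by balls, then some time
`σ⁽⁰⁾` is infinite and no path is recurrent. Otherwise, recurrence is almost surely the event
`VisitsLate` that the path comes arbitrarily close to `y` at arbitrarily late times. The analytic
input is the bound `IsRBMG.exists_le_measure_mem`: well inside the domain, the process agrees with
its driver with high probability (`SolvesSkorokhod.eq_of_driver_mem_ball`), and so, at the
parabolic scale, it reaches sets of a given relative volume with a probability bounded below. With
the strong Markov property at the returns to the unit ball around `y`, the escape lemma shows that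
late visits near `y` entail late visits near any `y'` (`IsRBMG.ae_visitsLate_of_visitsLate`). This
gives the first claim; it also gives the equivalence with `VisitsLate`, as a path that visits a
point at distance one from `y` has left the ball of radius `1 / 2` around `y`.

For the second claim, let the process from `x` stay for a short time `t` in a ball inside `D 0`.
Its law at time `t` is then absolutely continuous with respect to Lebesgue measure, because it
agrees with its driver. In turn, on `D 0` Lebesgue measure is absolutely continuous with respect to
the law at time `t` of the process from `z`, by connectedness and Lebesgue density points
(`IsRBMG.measure_mem_ne_zero_of_volume`). By the Markov property, an event of the future of `t`
that is null from `z` is therefore null from `x` (`IsRBMG.measure_future_eq_zero`). Late visits are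
invariant under time shifts, so that this applies to `VisitsLate` and to its complement, for
arbitrarily small `t`.
-/

/-! ### Recurrence of the random walk does not depend on the site -/

/-- If from each of the decreasing events `G k` the process escapes with conditional probability at
least `c > 0` through an event `C k` on which almost surely not all `G j` occur, then almost surely
not all `G k` occur: the measure of `G k \ ⋂ j, G j` tends to zero, but is at least
`c * P (⋂ j, G j)`. -/
theorem measure_iInter_eq_zero_of_escape {Ω : Type*} [MeasurableSpace Ω] {P : Measure Ω}
    [IsFiniteMeasure P] {G C : ℕ → Set Ω} (hG : ∀ k, MeasurableSet (G k)) (hanti : Antitone G)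
    (hCG : ∀ k, C k ⊆ G k) {c : ℝ≥0∞} (hc : c ≠ 0) (hcC : ∀ k, c * P (G k) ≤ P (C k))
    (hnull : ∀ k, P (C k ∩ ⋂ j, G j) = 0) : P (⋂ j, G j) = 0 := by
  have hmeas : MeasurableSet (⋂ j, G j) := MeasurableSet.iInter hG
  have hlim : Tendsto (fun k => P (G k) - P (⋂ j, G j)) atTop
      (𝓝 (P (⋂ j, G j) - P (⋂ j, G j))) := by
    refine ENNReal.Tendsto.sub ?_ tendsto_const_nhds (Or.inl (measure_ne_top _ _))
    exact tendsto_measure_iInter_atTop (fun k => (hG k).nullMeasurableSet) hanti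
      ⟨0, measure_ne_top _ _⟩
  have hle : ∀ k, c * P (⋂ j, G j) ≤ P (G k) - P (⋂ j, G j) := fun k => by
    have h1 : P (C k) ≤ P (G k \ ⋂ j, G j) := by
      calc P (C k) ≤ P ((C k ∩ ⋂ j, G j) ∪ (G k \ ⋂ j, G j)) := measure_mono fun ω hω => by
            by_cases h : ω ∈ ⋂ j, G j
            · exact Or.inl ⟨hω, h⟩
            · exact Or.inr ⟨hCG k hω, h⟩
        _ ≤ P (C k ∩ ⋂ j, G j) + P (G k \ ⋂ j, G j) := measure_union_le _ _
        _ = _ := by rw [hnull, zero_add]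
    rw [measure_sdiff (iInter_subset _ _) hmeas.nullMeasurableSet (measure_ne_top _ _)] at h1
    refine le_trans ?_ ((hcC k).trans h1)
    gcongr
    exact iInter_subset _ _
  have h0 : c * P (⋂ j, G j) ≤ 0 := by
    have := ge_of_tendsto' hlim hle
    rwa [tsub_self] at this
  simpa [hc] using h0

namespace IsSRW

variable {d : ℕ} {Ω : Type*} [MeasurableSpace Ω] {D : ℕ → (latticeGraph d).Subgraph}
  {x : Fin d → ℤ} {X : ℕ → Ω → (Fin d → ℤ)} {P : Measure Ω}

/-- The Markov property of the walk, for an arbitrary event of its past. -/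
theorem measure_past_step (h : IsSRW D x X P) (n : ℕ) (S : Set (Set.Iic n → Fin d → ℤ))
    (u v : Fin d → ℤ) :
    P {ω | (fun i : Set.Iic n => X i ω) ∈ S ∧ X n ω = u ∧ X (n + 1) ω = v}
      = P {ω | (fun i : Set.Iic n => X i ω) ∈ S ∧ X n ω = u} * srwStep (D (n + 1)) u v := by
  have hm := h.measurable
  have hp : Measurable fun (ω : Ω) (i : Set.Iic n) => X i ω := measurable_pi_lambda _ fun i => hm i
  have hu : MeasurableSet {ω | X n ω = u} := hm n (measurableSet_singleton u)
  have hv : MeasurableSet {ω | X (n + 1) ω = v} := hm (n + 1) (measurableSet_singleton v)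
  have key : (P.restrict ({ω | X n ω = u} ∩ {ω | X (n + 1) ω = v})).map
        (fun ω (i : Set.Iic n) => X i ω)
      = srwStep (D (n + 1)) u v •
        (P.restrict {ω | X n ω = u}).map (fun ω (i : Set.Iic n) => X i ω) := by
    refine Measure.ext_of_singleton fun a => ?_
    have past_eq : ∀ ω, (fun i : Set.Iic n => X i ω) = a
        ↔ ∀ i (hi : i ≤ n), X i ω = a ⟨i, Set.mem_Iic.2 hi⟩ := fun ω =>
      ⟨fun H i hi => congrFun H ⟨i, Set.mem_Iic.2 hi⟩, fun H => funext fun i => H i i.2⟩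
    rw [Measure.smul_apply, Measure.map_apply hp (measurableSet_singleton _),
      Measure.map_apply hp (measurableSet_singleton _),
      Measure.restrict_apply (hp (measurableSet_singleton _)),
      Measure.restrict_apply (hp (measurableSet_singleton _))]
    by_cases ha : a ⟨n, Set.mem_Iic.2 le_rfl⟩ = u
    · have h1 := h.step n (fun i => if hi : i ≤ n then a ⟨i, hi⟩ else v)
      have e1 : {ω | ∀ i ≤ n + 1, X i ω = if hi : i ≤ n then a ⟨i, hi⟩ else v}
          = (fun ω (i : Set.Iic n) => X i ω) ⁻¹' {a} ∩
            ({ω | X n ω = u} ∩ {ω | X (n + 1) ω = v}) := by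
        ext ω
        simp only [mem_ofPred_eq, mem_inter_iff, mem_preimage, mem_singleton_iff, past_eq]
        constructor
        · intro H
          refine ⟨fun i hi => by simpa [hi] using H i (by omega), ?_, ?_⟩
          · simpa [ha] using H n (by omega)
          · simpa using H (n + 1) le_rfl
        · rintro ⟨H1, H2, H3⟩ i hi
          by_cases hi' : i ≤ n
          · simpa [hi'] using H1 i hi'
          · obtain rfl : i = n + 1 := by omega
            simpa using H3
      have e2 : {ω | ∀ i ≤ n, X i ω = if hi : i ≤ n then a ⟨i, hi⟩ else v}
          = (fun ω (i : Set.Iic n) => X i ω) ⁻¹' {a} ∩ {ω | X n ω = u} := by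
        ext ω
        simp only [mem_ofPred_eq, mem_inter_iff, mem_preimage, mem_singleton_iff, past_eq]
        constructor
        · intro H
          refine ⟨fun i hi => by simpa [hi] using H i hi, ?_⟩
          simpa [ha] using H n le_rfl
        · rintro ⟨H1, H2⟩ i hi
          simpa [hi] using H1 i hi
      rw [e1, e2] at h1
      rw [h1]
      simp [ha, mul_comm]
    · have e : ∀ T : Set Ω, (fun ω (i : Set.Iic n) => X i ω) ⁻¹' {a} ∩ ({ω | X n ω = u} ∩ T)
          = ∅ := fun T => by
        ext ω
        simp only [mem_inter_iff, mem_preimage, mem_singleton_iff, mem_ofPred_eq,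
          mem_empty_iff_false, iff_false]
        rintro ⟨H, H', -⟩
        exact ha (by rw [← H]; exact H')
      have e' := e univ
      rw [inter_univ] at e'
      rw [e, e']
      simp
  have hS : MeasurableSet S := S.to_countable.measurableSet
  have := congrArg (fun μ => μ S) key
  simp only [Measure.smul_apply, smul_eq_mul] at this
  rw [Measure.map_apply hp hS, Measure.map_apply hp hS, Measure.restrict_apply (hp hS),
    Measure.restrict_apply (hp hS), mul_comm] at this
  exact this

/-- The Markov property of the walk, for an event of the past that is presented in any form. -/
theorem measure_step_of_past (h : IsSRW D x X P) (n : ℕ) {T : Set Ω}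
    (S : Set (Set.Iic n → Fin d → ℤ)) (hT : T = {ω | (fun i : Set.Iic n => X i ω) ∈ S})
    (u v : Fin d → ℤ) :
    P (T ∩ ({ω | X n ω = u} ∩ {ω | X (n + 1) ω = v}))
      = P (T ∩ {ω | X n ω = u}) * srwStep (D (n + 1)) u v := by
  subst hT
  exact h.measure_past_step n S u v

end IsSRW

theorem finite_neighborSet_latticeGraph {d : ℕ} (y : Fin d → ℤ) :
    ((latticeGraph d).neighborSet y).Finite := by
  refine (Set.finite_Icc (y - 1) (y + 1)).subset fun v hv => ?_
  have hv' : l1Norm (y - v) = 1 := hv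
  have h : ∀ i, |y i - v i| ≤ 1 := fun i => by
    rw [← hv']
    exact Finset.single_le_sum (f := fun i => |(y - v) i|) (fun j _ => abs_nonneg _)
      (Finset.mem_univ i)
  refine ⟨fun i => ?_, fun i => ?_⟩ <;>
  · have := abs_le.1 (h i)
    simp only [Pi.sub_apply, Pi.add_apply, Pi.one_apply]
    omega

theorem srwStep_of_adj {d : ℕ} {H : (latticeGraph d).Subgraph} {u v : Fin d → ℤ} (h : H.Adj u v) :
    srwStep H u v = ((H.neighborSet u).ncard : ℝ≥0∞)⁻¹ := by
  rw [srwStep, if_pos ⟨v, h⟩, if_pos h]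

theorem srwStep_ne_zero_of_adj {d : ℕ} {H : (latticeGraph d).Subgraph} {u v : Fin d → ℤ}
    (h : H.Adj u v) : srwStep H u v ≠ 0 := by
  rw [srwStep_of_adj h]
  exact ENNReal.inv_ne_zero.2 (ENNReal.natCast_ne_top _)

theorem le_srwStep_of_adj {d : ℕ} {H : (latticeGraph d).Subgraph} {u v : Fin d → ℤ}
    (h : H.Adj u v) : (((latticeGraph d).neighborSet u).ncard : ℝ≥0∞)⁻¹ ≤ srwStep H u v := by
  rw [srwStep_of_adj h]
  exact ENNReal.inv_le_inv.2 (Nat.cast_le.2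
    (Set.ncard_le_ncard (H.neighborSet_subset u) (finite_neighborSet_latticeGraph u)))

namespace IsSRW

variable {d : ℕ} {Ω : Type*} [MeasurableSpace Ω] {D : ℕ → (latticeGraph d).Subgraph}
  {x : Fin d → ℤ} {X : ℕ → Ω → (Fin d → ℤ)} {P : Measure Ω}

/-- Along an edge that is open from time `T` on, infinitely many visits pass from `y` to `y'`: at
each first visit to `y` after a given time, the walk moves on to `y'` with a probability bounded
below by the inverse of the degree of `y` in the full lattice. -/
theorem ae_frequently_of_adj (h : IsSRW D x X P) (hD : Monotone D) {T : ℕ} {y y' : Fin d → ℤ}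
    (hadj : (D T).Adj y y') :
    ∀ᵐ ω ∂P, (∃ᶠ t in atTop, X t ω = y) → ∃ᶠ t in atTop, X t ω = y' := by
  have := h.isProbabilityMeasure
  have hm : ∀ t v, MeasurableSet {ω | X t ω = v} :=
    fun t v => h.measurable t (measurableSet_singleton v)
  have key : ∀ n, ∀ᵐ ω ∂P, (∃ᶠ t in atTop, X t ω = y) → ∃ t ≥ n, X t ω = y' := by
    intro n
    -- from time `N` on, the edge between `y` and `y'` is open
    set N := max n T
    -- `A k`: no visit to `y'` in `[n, N + k]`; `F k j`: no visit to `y` in `[N + k, N + k + j)`;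
    -- `G k`: `A k` and a visit to `y` after time `N + k`; `C k`: at the first such visit, the walk
    -- moves on to `y'`
    let A : ℕ → Set Ω := fun k => {ω | ∀ t, n ≤ t → t ≤ N + k → X t ω ≠ y'}
    let F : ℕ → ℕ → Set Ω := fun k j => {ω | ∀ i < j, X (N + k + i) ω ≠ y}
    let G : ℕ → Set Ω := fun k => A k ∩ ⋃ j, {ω | X (N + k + j) ω = y}
    let C : ℕ → Set Ω := fun k =>
      ⋃ j, (A k ∩ F k j) ∩ ({ω | X (N + k + j) ω = y} ∩ {ω | X (N + k + j + 1) ω = y'})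
    have hA : ∀ k, MeasurableSet (A k) := fun k => by
      have : A k = ⋂ (t) (_ : n ≤ t) (_ : t ≤ N + k), {ω | X t ω = y'}ᶜ := by
        ext ω; simp [A]
      rw [this]
      exact MeasurableSet.iInter fun t => MeasurableSet.iInter fun _ => MeasurableSet.iInter
        fun _ => (hm t y').compl
    have hF : ∀ k j, MeasurableSet (F k j) := fun k j => by
      have : F k j = ⋂ (i) (_ : i < j), {ω | X (N + k + i) ω = y}ᶜ := by
        ext ω; simp [F]
      rw [this]
      exact MeasurableSet.iInter fun t => MeasurableSet.iInter fun _ => (hm _ y).compl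
    have hG : ∀ k, MeasurableSet (G k) :=
      fun k => (hA k).inter (MeasurableSet.iUnion fun j => hm _ y)
    have hfirst : ∀ k, G k = ⋃ j, (A k ∩ F k j) ∩ {ω | X (N + k + j) ω = y} := fun k => by
      classical
      ext ω
      simp only [G, mem_inter_iff, mem_iUnion]
      constructor
      · rintro ⟨ha, hj⟩
        exact ⟨Nat.find hj, ⟨ha, fun i hi => Nat.find_min hj hi⟩, Nat.find_spec hj⟩
      · rintro ⟨j, ⟨ha, -⟩, hj⟩
        exact ⟨ha, j, hj⟩
    have hdisj : ∀ k (E : ℕ → Set Ω), (∀ j, E j ⊆ {ω | X (N + k + j) ω = y}) →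
        Pairwise (Function.onFun Disjoint fun j => (A k ∩ F k j) ∩ E j) := by
      intro k E hE i j hij
      rw [Function.onFun, Set.disjoint_left]
      rintro ω ⟨⟨-, hi⟩, hi'⟩ ⟨⟨-, hj⟩, hj'⟩
      rcases lt_or_gt_of_ne hij with hlt | hlt
      · exact hj i hlt (hE i hi')
      · exact hi j hlt (hE j hj')
    have hzero : P (⋂ k, G k) = 0 := by
      refine measure_iInter_eq_zero_of_escape (C := C)
        (c := (((latticeGraph d).neighborSet y).ncard : ℝ≥0∞)⁻¹) hG ?_ ?_ ?_ ?_ ?_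
      · refine antitone_nat_of_succ_le fun k => ?_
        rintro ω ⟨ha, hj⟩
        obtain ⟨j, hj⟩ := mem_iUnion.1 hj
        refine ⟨fun t ht ht' => ha t ht (by omega), mem_iUnion.2 ⟨j + 1, ?_⟩⟩
        have : N + k + (j + 1) = N + (k + 1) + j := by omega
        simpa only [mem_ofPred_eq, this] using hj
      · intro k
        rw [hfirst]
        exact iUnion_mono fun j => inter_subset_inter_right _ fun ω hω => hω.1
      · exact ENNReal.inv_ne_zero.2 (ENNReal.natCast_ne_top _)
      · intro k
        rw [hfirst, measure_iUnion (hdisj k _ fun j => subset_rfl)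
          (fun j => ((hA k).inter (hF k j)).inter (hm _ y)),
          measure_iUnion (hdisj k _ fun j => fun ω hω => hω.1)
          (fun j => ((hA k).inter (hF k j)).inter ((hm _ y).inter (hm _ y'))),
          ← ENNReal.tsum_mul_left]
        refine ENNReal.tsum_le_tsum fun j => ?_
        rw [h.measure_step_of_past (T := A k ∩ F k j) (N + k + j)
            {v | (∀ t (ht : n ≤ t) (ht' : t ≤ N + k),
            v ⟨t, Set.mem_Iic.2 (by omega)⟩ ≠ y') ∧ ∀ i (hi : i < j),
            v ⟨N + k + i, Set.mem_Iic.2 (by omega)⟩ ≠ y} rfl, mul_comm]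
        gcongr
        refine le_srwStep_of_adj ?_
        exact (hD (show T ≤ N + k + j + 1 by omega)).2 hadj
      · intro k
        convert measure_empty (μ := P)
        rw [eq_empty_iff_forall_notMem]
        rintro ω ⟨hC, hGω⟩
        obtain ⟨j, -, -, hj⟩ := mem_iUnion.1 hC
        exact (mem_iInter.1 hGω (k + j + 1)).1 (N + k + j + 1) (by omega) (by omega) hj
    have hnot : ∀ᵐ ω ∂P, ω ∉ ⋂ k, G k := measure_eq_zero_iff_ae_notMem.1 hzero
    filter_upwards [hnot] with ω hω hfreq
    by_contra! hnone
    refine hω (mem_iInter.2 fun k => ⟨fun t ht _ => hnone t ht, mem_iUnion.2 ?_⟩)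
    obtain ⟨t, ht, hty⟩ := frequently_atTop.1 hfreq (N + k)
    obtain ⟨j, rfl⟩ := Nat.exists_eq_add_of_le ht
    exact ⟨j, hty⟩
  filter_upwards [ae_all_iff.2 key] with ω hω hfreq
  exact frequently_atTop.2 fun n => hω n hfreq

theorem ae_frequently_of_frequently (h : IsSRW D x X P) (hD : Monotone D)
    (hconn : ∀ t, (D t).Connected) (huniv : (⋃ t, (D t).verts) = univ) (y y' : Fin d → ℤ) :
    ∀ᵐ ω ∂P, (∃ᶠ t in atTop, X t ω = y) → ∃ᶠ t in atTop, X t ω = y' := by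
  obtain ⟨s, hs⟩ := mem_iUnion.1 (huniv ▸ mem_univ y : y ∈ ⋃ t, (D t).verts)
  obtain ⟨s', hs'⟩ := mem_iUnion.1 (huniv ▸ mem_univ y' : y' ∈ ⋃ t, (D t).verts)
  have hT : y ∈ (D (max s s')).verts := (hD (le_max_left s s')).1 hs
  have hT' : y' ∈ (D (max s s')).verts := (hD (le_max_right s s')).1 hs'
  obtain ⟨p⟩ := (hconn (max s s')).coe.preconnected ⟨y, hT⟩ ⟨y', hT'⟩
  suffices H : ∀ (a b : (D (max s s')).verts), (D (max s s')).coe.Walk a b →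
      ∀ᵐ ω ∂P, (∃ᶠ t in atTop, X t ω = a) → ∃ᶠ t in atTop, X t ω = b from H _ _ p
  intro a b p
  induction p with
  | nil => exact Eventually.of_forall fun ω hω => hω
  | cons hadj _ ih =>
    filter_upwards [ih, h.ae_frequently_of_adj hD hadj] with ω h1 h2 h3 using h1 (h2 h3)

theorem measure_isWalkRecurrent_eq (h : IsSRW D x X P) (hD : Monotone D)
    (hconn : ∀ t, (D t).Connected) (huniv : (⋃ t, (D t).verts) = univ) (y y' : Fin d → ℤ) :
    P {ω | IsWalkRecurrent x y (fun t => X t ω)}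
      = P {ω | IsWalkRecurrent x y' (fun t => X t ω)} := by
  refine measure_congr ?_
  filter_upwards [h.ae_frequently_of_frequently hD hconn huniv y y',
    h.ae_frequently_of_frequently hD hconn huniv y' y] with ω h1 h2
  exact propext ⟨fun H => ⟨H.1, h1 H.2⟩, fun H => ⟨H.1, h2 H.2⟩⟩

end IsSRW

/-! ### Random walks from starting points of the same parity -/

/-- A finite measure on a product space is determined by its finite-dimensional marginals. No
structure of the factors beyond measurability is needed. -/
theorem measure_pi_ext_of_squareCylinders {ι : Type*} {E : ι → Type*} [∀ i, MeasurableSpace (E i)]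
    {μ ν : Measure (∀ i, E i)} [IsFiniteMeasure μ]
    (h : ∀ (I : Finset ι) (B : ∀ i, Set (E i)), (∀ i, MeasurableSet (B i)) →
      μ ((I : Set ι).pi B) = ν ((I : Set ι).pi B)) : μ = ν := by
  refine ext_of_generate_finite _ generateFrom_squareCylinders.symm
    (isPiSystem_squareCylinders (fun _ => MeasurableSpace.isPiSystem_measurableSet) (by simp)) ?_ ?_
  · rintro - ⟨I, B, hB, rfl⟩
    exact h I B fun i => hB i (mem_univ i)
  · simpa using h ∅ (fun _ => univ) fun _ => MeasurableSet.univ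

theorem measure_nat_ext_of_cylinders {E : Type*} [MeasurableSpace E] [MeasurableSingletonClass E]
    [Countable E] {μ ν : Measure (ℕ → E)} [IsFiniteMeasure μ]
    (h : ∀ (m : ℕ) (w : ℕ → E), μ {v | ∀ i ≤ m, v i = w i} = ν {v | ∀ i ≤ m, v i = w i}) :
    μ = ν := by
  refine measure_pi_ext_of_squareCylinders fun I B _ => ?_
  set m := I.sup id
  have hI : ∀ i ∈ I, i ≤ m := fun i hi => Finset.le_sup (f := id) hi
  let r : (ℕ → E) → (Set.Iic m → E) := fun v i => v i
  have hr : Measurable r := measurable_pi_lambda _ fun i => measurable_pi_apply _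
  have hmap : μ.map r = ν.map r := by
    refine Measure.ext_of_singleton fun a => ?_
    rw [Measure.map_apply hr (measurableSet_singleton _),
      Measure.map_apply hr (measurableSet_singleton _)]
    have : r ⁻¹' {a} = {v | ∀ i ≤ m, v i = a ⟨min i m, Set.mem_Iic.2 (min_le_right _ _)⟩} := by
      ext v
      simp only [mem_preimage, mem_singleton_iff, mem_ofPred_eq, r]
      constructor
      · rintro rfl i hi
        simp [min_eq_left hi]
      · intro H
        funext i
        have hi : (i : ℕ) ≤ m := i.2
        simpa [min_eq_left hi] using H i hi
    rw [this, h]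
  have hpre : (I : Set ℕ).pi B =
      r ⁻¹' {a | ∀ i (hi : i ∈ I), a ⟨i, Set.mem_Iic.2 (hI i hi)⟩ ∈ B i} := by
    ext v
    simp [r, Set.mem_pi]
  have hS : ∀ S : Set (Set.Iic m → E), MeasurableSet S := fun S => S.to_countable.measurableSet
  rw [hpre, ← Measure.map_apply hr (hS _), hmap, Measure.map_apply hr (hS _)]

namespace IsSRW

variable {d : ℕ} {Ω : Type*} [MeasurableSpace Ω] {D : ℕ → (latticeGraph d).Subgraph}
  {x z : Fin d → ℤ} {X : ℕ → Ω → (Fin d → ℤ)} {P Q : Measure Ω}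

theorem measure_cylinder_mul (h : IsSRW D x X P) (h' : IsSRW D z X Q) (t : ℕ) (u : Fin d → ℤ)
    (w : ℕ → Fin d → ℤ) (m : ℕ) :
    P ({ω | X t ω = u} ∩ {ω | ∀ i ≤ m, X (t + i) ω = w i}) * Q {ω | X t ω = u}
      = Q ({ω | X t ω = u} ∩ {ω | ∀ i ≤ m, X (t + i) ω = w i}) * P {ω | X t ω = u} := by
  induction m with
  | zero =>
    by_cases hu : w 0 = u
    · have : {ω | ∀ i ≤ 0, X (t + i) ω = w i} = {ω | X t ω = u} := by ext ω; simp [hu]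
      rw [this, inter_self, mul_comm]
    · have : {ω | X t ω = u} ∩ {ω | ∀ i ≤ 0, X (t + i) ω = w i} = ∅ := by
        ext ω
        simp only [mem_inter_iff, mem_ofPred_eq, mem_empty_iff_false, iff_false]
        rintro ⟨h1, h2⟩
        exact hu ((h2 0 le_rfl).symm.trans h1)
      rw [this, measure_empty, measure_empty, zero_mul, zero_mul]
  | succ m ih =>
    have e : {ω | X t ω = u} ∩ {ω | ∀ i ≤ m + 1, X (t + i) ω = w i}
        = ({ω | X t ω = u} ∩ {ω | ∀ i ≤ m, X (t + i) ω = w i}) ∩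
          ({ω | X (t + m) ω = w m} ∩ {ω | X (t + m + 1) ω = w (m + 1)}) := by
      ext ω
      simp only [mem_inter_iff, mem_ofPred_eq]
      constructor
      · rintro ⟨h1, h2⟩
        exact ⟨⟨h1, fun i hi => h2 i (by omega)⟩, h2 m (by omega), h2 (m + 1) le_rfl⟩
      · rintro ⟨⟨h1, h2⟩, -, h4⟩
        refine ⟨h1, fun i hi => ?_⟩
        rcases Nat.lt_or_ge m i with h5 | h5
        · obtain rfl : i = m + 1 := by omega
          exact h4
        · exact h2 i h5
    have e' : ({ω | X t ω = u} ∩ {ω | ∀ i ≤ m, X (t + i) ω = w i}) ∩ {ω | X (t + m) ω = w m}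
        = {ω | X t ω = u} ∩ {ω | ∀ i ≤ m, X (t + i) ω = w i} :=
      inter_eq_left.2 fun ω hω => hω.2 m le_rfl
    have hpast : {ω | X t ω = u} ∩ {ω | ∀ i ≤ m, X (t + i) ω = w i}
        = {ω | (fun i : Set.Iic (t + m) => X i ω) ∈ {v : Set.Iic (t + m) → Fin d → ℤ |
            v ⟨t, Set.mem_Iic.2 (by omega)⟩ = u ∧
            ∀ i (hi : i ≤ m), v ⟨t + i, Set.mem_Iic.2 (by omega)⟩ = w i}} := by
      ext ω
      simp
    rw [e, h.measure_step_of_past (t + m) _ hpast, h'.measure_step_of_past (t + m) _ hpast, e',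
      mul_right_comm, ih, mul_right_comm]

/-- Two walks on the same graphs that are at `u` at time `t` have the same conditional law of the
future. The identity is cleared of denominators, so it holds when `u` cannot be reached. -/
theorem measure_shift_mul (h : IsSRW D x X P) (h' : IsSRW D z X Q) (t : ℕ) (u : Fin d → ℤ)
    {Γ : Set (ℕ → Fin d → ℤ)} (hΓ : MeasurableSet Γ) :
    P ({ω | X t ω = u} ∩ {ω | (fun n => X (t + n) ω) ∈ Γ}) * Q {ω | X t ω = u}
      = Q ({ω | X t ω = u} ∩ {ω | (fun n => X (t + n) ω) ∈ Γ}) * P {ω | X t ω = u} := by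
  have := h.isProbabilityMeasure
  have := h'.isProbabilityMeasure
  have hs : Measurable fun (ω : Ω) (n : ℕ) => X (t + n) ω :=
    measurable_pi_lambda _ fun n => h.measurable _
  have hcyl : ∀ (m : ℕ) (w : ℕ → Fin d → ℤ),
      MeasurableSet {v : ℕ → Fin d → ℤ | ∀ i ≤ m, v i = w i} := fun m w => by
    simp only [ofPred_forall]
    exact MeasurableSet.iInter fun i => MeasurableSet.iInter fun _ =>
      measurable_pi_apply i (measurableSet_singleton _)
  have hfin : Q {ω | X t ω = u} ≠ ⊤ := measure_ne_top _ _
  have key : Q {ω | X t ω = u} • (P.restrict {ω | X t ω = u}).map (fun ω n => X (t + n) ω)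
      = P {ω | X t ω = u} • (Q.restrict {ω | X t ω = u}).map (fun ω n => X (t + n) ω) := by
    have : IsFiniteMeasure
        (Q {ω | X t ω = u} • (P.restrict {ω | X t ω = u}).map (fun ω n => X (t + n) ω)) :=
      Measure.smul_finite _ hfin
    refine measure_nat_ext_of_cylinders fun m w => ?_
    simp only [Measure.smul_apply, smul_eq_mul]
    rw [Measure.map_apply hs (hcyl m w), Measure.map_apply hs (hcyl m w),
      Measure.restrict_apply (hs (hcyl m w)), Measure.restrict_apply (hs (hcyl m w)), inter_comm,
      mul_comm (Q {ω | X t ω = u}), mul_comm (P {ω | X t ω = u})]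
    exact h.measure_cylinder_mul h' t u w m
  have := congrArg (fun μ => μ Γ) key
  simp only [Measure.smul_apply, smul_eq_mul] at this
  rw [Measure.map_apply hs hΓ, Measure.map_apply hs hΓ, Measure.restrict_apply (hs hΓ),
    Measure.restrict_apply (hs hΓ), inter_comm, mul_comm (Q {ω | X t ω = u}),
    mul_comm (P {ω | X t ω = u})] at this
  exact this

theorem measure_succ_ne_zero (h : IsSRW D x X P) {n : ℕ} {u v : Fin d → ℤ}
    (hu : P {ω | X n ω = u} ≠ 0) (hadj : (D (n + 1)).Adj u v) : P {ω | X (n + 1) ω = v} ≠ 0 := by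
  have h1 := h.measure_step_of_past (T := univ) n univ (by ext; simp) u v
  rw [univ_inter, univ_inter] at h1
  have h2 : P ({ω | X n ω = u} ∩ {ω | X (n + 1) ω = v}) ≠ 0 := by
    rw [h1]
    exact mul_ne_zero hu (srwStep_ne_zero_of_adj hadj)
  exact fun h0 => h2 (measure_mono_null inter_subset_right h0)

theorem exists_of_measure_succ_ne_zero (h : IsSRW D x X P) {n : ℕ} {v : Fin d → ℤ}
    (hv : P {ω | X (n + 1) ω = v} ≠ 0) :
    ∃ u, P {ω | X n ω = u} ≠ 0 ∧ srwStep (D (n + 1)) u v ≠ 0 := by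
  by_contra! H
  refine hv (measure_mono_null (t := ⋃ u, {ω | X n ω = u} ∩ {ω | X (n + 1) ω = v})
    (fun ω hω => mem_iUnion.2 ⟨X n ω, rfl, hω⟩) (measure_iUnion_null fun u => ?_))
  have h1 := h.measure_step_of_past (T := univ) n univ (by ext; simp) u v
  rw [univ_inter, univ_inter] at h1
  rw [h1]
  by_cases hu : P {ω | X n ω = u} = 0
  · rw [hu, zero_mul]
  · rw [H u hu, mul_zero]

end IsSRW

theorem even_l1Norm_add {d : ℕ} (u v : Fin d → ℤ) :
    Even (l1Norm (u + v)) ↔ (Even (l1Norm u) ↔ Even (l1Norm v)) := by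
  have habs : ∀ w : Fin d → ℤ, Even (l1Norm w) ↔ Even (∑ i, w i) := fun w => by
    have : Even (l1Norm w - ∑ i, w i) := by
      rw [l1Norm, ← Finset.sum_sub_distrib]
      refine Finset.even_sum _ fun i _ => ?_
      rcases abs_choice (w i) with hw | hw <;> rw [hw]
      · simp
      · exact ⟨-w i, by ring⟩
    rw [Int.even_sub] at this
    exact this
  rw [habs, habs, habs, ← Int.even_add, ← Finset.sum_add_distrib]
  rfl

theorem even_l1Norm_sub_iff_of_adj {d : ℕ} {u v : Fin d → ℤ} (h : (latticeGraph d).Adj u v)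
    (z : Fin d → ℤ) : Even (l1Norm (v - z)) ↔ ¬Even (l1Norm (u - z)) := by
  have h1 : ¬Even (l1Norm (u - v)) := by
    rw [show l1Norm (u - v) = 1 from h]; decide
  have h2 := even_l1Norm_add (u - v) (v - z)
  rw [sub_add_sub_cancel] at h2
  tauto

theorem exists_adj_of_mem {d : ℕ} {D : ℕ → (latticeGraph d).Subgraph} {x z : Fin d → ℤ}
    (hD : Monotone D) (hconn : ∀ t, (D t).Connected)
    (hx : x ∈ (D 0).verts) (hz : z ∈ (D 0).verts) (hxz : x ≠ z) {t : ℕ} {u : Fin d → ℤ}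
    (hu : u ∈ (D t).verts) : ∃ v, (D t).Adj u v := by
  obtain ⟨b, hb, hbu⟩ : ∃ b ∈ (D t).verts, b ≠ u := by
    by_cases hxu : x = u
    · exact ⟨z, (hD (Nat.zero_le t)).1 hz, fun hzu => hxz (hxu.trans hzu.symm)⟩
    · exact ⟨x, (hD (Nat.zero_le t)).1 hx, hxu⟩
  obtain ⟨p⟩ := (hconn t).coe.preconnected ⟨u, hu⟩ ⟨b, hb⟩
  cases p with
  | nil => exact absurd rfl hbu
  | cons hadj _ => exact ⟨_, hadj⟩

namespace IsSRW

variable {d : ℕ} {Ω : Type*} [MeasurableSpace Ω] {D : ℕ → (latticeGraph d).Subgraph}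
  {x z : Fin d → ℤ} {X : ℕ → Ω → (Fin d → ℤ)} {P Q : Measure Ω}

/-- The initial graph has two vertices, hence no vertex is ever isolated and the walk never stays
put: its distance from the start has the parity of the time. -/
theorem parity_of_measure_ne_zero (h : IsSRW D x X P) (hD : Monotone D)
    (hconn : ∀ t, (D t).Connected) (hx : x ∈ (D 0).verts) (hz : z ∈ (D 0).verts) (hxz : x ≠ z)
    (t : ℕ) {u : Fin d → ℤ} (hu : P {ω | X t ω = u} ≠ 0) :
    u ∈ (D t).verts ∧ (Even t ↔ Even (l1Norm (u - x))) := by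
  induction t generalizing u with
  | zero =>
    obtain rfl : u = x := by
      by_contra hux
      refine hu ?_
      rw [measure_eq_zero_iff_ae_notMem]
      filter_upwards [h.start] with ω hω h0
      exact hux (h0.symm.trans hω)
    exact ⟨hx, by simp [l1Norm]⟩
  | succ t ih =>
    obtain ⟨w, hw, hstep⟩ := h.exists_of_measure_succ_ne_zero hu
    obtain ⟨hwD, hpar⟩ := ih hw
    obtain ⟨v, hv⟩ := exists_adj_of_mem hD hconn hx hz hxz ((hD (Nat.le_succ t)).1 hwD)
    have hadj : (D (t + 1)).Adj w u := by
      by_contra hno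
      rw [srwStep, if_pos ⟨v, hv⟩, if_neg hno] at hstep
      exact hstep rfl
    refine ⟨hadj.snd_mem, ?_⟩
    rw [even_l1Norm_sub_iff_of_adj hadj.adj_sub x, ← hpar, Nat.even_add_one]

/-- The walk from `z` can be at `x` at all large even times: it reaches `x` inside the initial
graph, and then goes back and forth along an edge at `x`. -/
theorem measure_ne_zero_of_even (h : IsSRW D z X Q) (hD : Monotone D)
    (hconn : ∀ t, (D t).Connected) (hx : x ∈ (D 0).verts) (hz : z ∈ (D 0).verts) (hxz : x ≠ z)
    (heven : Even (l1Norm (x - z))) :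
    ∃ k, ∀ t ≥ k, Even t → Q {ω | X t ω = x} ≠ 0 := by
  have := h.isProbabilityMeasure
  have hstart : Q {ω | X 0 ω = z} ≠ 0 := by
    intro h0
    have hne : ∀ᵐ ω ∂Q, X 0 ω ≠ z := measure_eq_zero_iff_ae_notMem.1 h0
    obtain ⟨ω, h1, h2⟩ := (h.start.and hne).exists
    exact h2 h1
  have hreach : ∀ (a b : (D 0).verts), (D 0).coe.Walk a b → (∃ k, Q {ω | X k ω = a} ≠ 0) →
      ∃ k, Q {ω | X k ω = b} ≠ 0 := by
    intro a b p
    induction p with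
    | nil => exact fun H => H
    | cons hadj _ ih =>
      rintro ⟨k, hk⟩
      exact ih ⟨k + 1, h.measure_succ_ne_zero hk ((hD (Nat.zero_le _)).2 hadj)⟩
  obtain ⟨p⟩ := (hconn 0).coe.preconnected ⟨z, hz⟩ ⟨x, hx⟩
  obtain ⟨k, hk⟩ := hreach _ _ p ⟨0, hstart⟩
  have hkeven : Even k := (h.parity_of_measure_ne_zero hD hconn hz hx hxz.symm k hk).2.2 heven
  obtain ⟨v, hv⟩ := exists_adj_of_mem hD hconn hx hz hxz hx
  have hpad : ∀ j, Q {ω | X (k + 2 * j) ω = x} ≠ 0 := by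
    intro j
    induction j with
    | zero => exact hk
    | succ j ih =>
      have h1 := h.measure_succ_ne_zero ih ((hD (Nat.zero_le _)).2 hv)
      exact h.measure_succ_ne_zero h1 ((hD (Nat.zero_le _)).2 hv.symm)
  refine ⟨k, fun t ht hteven => ?_⟩
  obtain ⟨a, rfl⟩ := Nat.exists_eq_add_of_le ht
  obtain ⟨j, rfl⟩ := (Nat.even_add.1 hteven).1 hkeven
  rw [← two_mul]
  exact hpad j

theorem measure_isWalkRecurrent_eq_zero (h : IsSRW D x X P) (h' : IsSRW D z X Q) (hD : Monotone D)
    (hconn : ∀ t, (D t).Connected) (huniv : (⋃ t, (D t).verts) = univ)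
    (hx : x ∈ (D 0).verts) (hz : z ∈ (D 0).verts) (hxz : x ≠ z)
    (heven : Even (l1Norm (x - z))) {y : Fin d → ℤ}
    (hQ : Q {ω | IsWalkRecurrent z y (fun t => X t ω)} = 0) :
    P {ω | IsWalkRecurrent x y (fun t => X t ω)} = 0 := by
  have := h.isProbabilityMeasure
  obtain ⟨k, hk⟩ := h'.measure_ne_zero_of_even hD hconn hx hz hxz heven
  have hΓ : MeasurableSet {w : ℕ → Fin d → ℤ | ∃ᶠ t in atTop, w t = y} := by
    simp only [frequently_atTop, ofPred_forall, ofPred_exists]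
    refine MeasurableSet.iInter fun a => MeasurableSet.iUnion fun b => ?_
    exact (MeasurableSet.const (b ≥ a)).inter
      (measurable_pi_apply (X := fun _ : ℕ => Fin d → ℤ) b (measurableSet_singleton y))
  have hshift : ∀ (t : ℕ) (w : ℕ → Fin d → ℤ),
      (∃ᶠ n in atTop, w (t + n) = y) ↔ ∃ᶠ n in atTop, w n = y := fun t w => by
    conv_rhs => rw [← map_add_atTop_eq_nat t, frequently_map]
    simp only [add_comm]
  -- the event that the walk is at `x` at time `t` and recurrent has probability zero
  have hzero : ∀ t ≥ k, P ({ω | X t ω = x} ∩ {ω | ∃ᶠ n in atTop, X (t + n) ω = y}) = 0 := by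
    intro t ht
    by_cases hPt : P {ω | X t ω = x} = 0
    · exact measure_mono_null inter_subset_left hPt
    have hteven : Even t := by
      refine (h.parity_of_measure_ne_zero hD hconn hx hz hxz t hPt).2.2 ?_
      simp [l1Norm]
    have hmul := h.measure_shift_mul h' t x hΓ
    have hQ0 : Q ({ω | X t ω = x} ∩ {ω | (fun n => X (t + n) ω) ∈
        {w : ℕ → Fin d → ℤ | ∃ᶠ t in atTop, w t = y}}) = 0 := by
      rw [measure_eq_zero_iff_ae_notMem] at hQ ⊢
      filter_upwards [hQ, h'.start] with ω h1 h2 h3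
      exact h1 ⟨h2, (hshift t fun n => X n ω).1 h3.2⟩
    rw [hQ0, zero_mul] at hmul
    exact (mul_eq_zero.1 hmul).resolve_right (hk t ht hteven)
  have hall : ∀ᵐ ω ∂P, ∀ t, t ≥ k →
      ω ∉ {ω | X t ω = x} ∩ {ω | ∃ᶠ n in atTop, X (t + n) ω = y} :=
    ae_all_iff.2 fun t => by
      by_cases ht : t ≥ k
      · filter_upwards [measure_eq_zero_iff_ae_notMem.1 (hzero t ht)] with ω hω _ using hω
      · exact Eventually.of_forall fun ω h0 => absurd h0 ht
  rw [measure_eq_zero_iff_ae_notMem]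
  filter_upwards [hall, h.ae_frequently_of_frequently hD hconn huniv y x] with ω h1 h2 h3
  obtain ⟨t, ht, htx⟩ := frequently_atTop.1 (h2 h3.2) k
  exact h1 t ht ⟨htx, (hshift t fun n => X n ω).2 h3.2⟩

end IsSRW

/-! ### Solutions of the Skorokhod problem inside a ball, and late visits of paths -/

theorem stieltjesFrom_Ioc {s t : ℝ≥0} {ℓ : ℝ≥0 → ℝ} (hc : ContinuousOn ℓ (Ici s))
    (hm : MonotoneOn ℓ (Ici s)) (hst : s ≤ t) :
    stieltjesFrom s ℓ (Ioc s t) = ENNReal.ofReal (ℓ t - ℓ s) := by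
  have hmono : Monotone fun u => ℓ (max s u) := fun a b hab =>
    hm (mem_Ici.2 (le_max_left _ _)) (mem_Ici.2 (le_max_left _ _)) (max_le_max le_rfl hab)
  have hcont : Continuous fun u => ℓ (max s u) :=
    hc.comp_continuous (by fun_prop) fun u => mem_Ici.2 (le_max_left _ _)
  have hlim : ∀ u, Function.rightLim (fun u => ℓ (max s u)) u = ℓ (max s u) := fun u =>
    hcont.continuousAt.continuousWithinAt.rightLim_eq
  rw [stieltjesFrom, dif_pos hmono, StieltjesFunction.measure_Ioc,
    hmono.stieltjesFunction_eq, hmono.stieltjesFunction_eq, hlim, hlim]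
  simp [hst]

namespace SolvesSkorokhod

variable {d : ℕ} {D : ℝ≥0 → Set (EuclideanSpace ℝ (Fin d))}
  {b : ℝ≥0 → EuclideanSpace ℝ (Fin d)} {s : ℝ≥0} {x : EuclideanSpace ℝ (Fin d)}
  {w : ℝ≥0 → EuclideanSpace ℝ (Fin d)} {ℓ : ℝ≥0 → ℝ}

theorem start (h : SolvesSkorokhod D b s x w ℓ) : w s = x := by
  rw [h.path_eq s le_rfl]
  simp

/-- While the path stays in a ball contained in the domain, it moves with the driver. As the domains
grow, its points in time-space after time `s` are interior, so that the local time does not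
increase. -/
theorem eq_of_forall_mem_ball (h : SolvesSkorokhod D b s x w ℓ) (hD : Monotone D)
    {a : EuclideanSpace ℝ (Fin d)} {R : ℝ} (hball : Metric.ball a R ⊆ D s) {t : ℝ≥0} (hst : s ≤ t)
    (hw : ∀ u ∈ Ioc s t, w u ∈ Metric.ball a R) : w t = x + b t - b s := by
  have hempty : Ioc s t ∩ {u | (u, w u) ∈ frontier (timeSpace D)} = ∅ := by
    rw [eq_empty_iff_forall_notMem]
    rintro u ⟨hu, hfr⟩
    refine hfr.2 (mem_interior.2 ⟨Ioi s ×ˢ Metric.ball a R, ?_, isOpen_Ioi.prod Metric.isOpen_ball,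
      ⟨hu.1, hw u hu⟩⟩)
    rintro ⟨r, v⟩ ⟨hr, hv⟩
    exact hD (le_of_lt hr) (hball hv)
  have hℓt : ℓ t = 0 := by
    rw [h.local_eq t hst, hempty]; simp
  have hℓs : ℓ s = 0 := by
    rw [h.local_eq s le_rfl]; simp
  have hzero : stieltjesFrom s ℓ (Ioc s t) = 0 := by
    rw [stieltjesFrom_Ioc h.continuousOn_local h.monotoneOn_local hst, hℓt, hℓs]; simp
  rw [h.path_eq t hst, Measure.restrict_eq_zero.2 hzero, integral_zero_measure, add_zero]

/-- If the driver, started from `x`, stays in a ball contained in the domain, then so does the path: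
up to its first exit from the ball the path agrees with the driver, and so by continuity it is in
the ball at that time, too. -/
theorem eq_of_driver_mem_ball (h : SolvesSkorokhod D b s x w ℓ) (hD : Monotone D)
    {a : EuclideanSpace ℝ (Fin d)} {R : ℝ} (hball : Metric.ball a R ⊆ D s) {T : ℝ≥0} (hsT : s ≤ T)
    (hb : Continuous b) (hw : ∀ u ∈ Icc s T, x + b u - b s ∈ Metric.ball a R) :
    w T = x + b T - b s := by
  have hcw : ContinuousOn w (Icc s T) := h.continuousOn_path.mono Icc_subset_Ici_self
  refine h.eq_of_forall_mem_ball hD hball hsT ?_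
  by_contra! hex
  obtain ⟨u₀, hu₀, hout⟩ := hex
  -- `E` is the compact set of times at which the path is outside the ball
  let E : Set ℝ≥0 := Icc s T ∩ w ⁻¹' (Metric.ball a R)ᶜ
  have hEc : IsCompact E := isCompact_Icc.of_isClosed_subset
    (hcw.preimage_isClosed_of_isClosed isClosed_Icc Metric.isOpen_ball.isClosed_compl)
    inter_subset_left
  obtain ⟨v, ⟨hvI, hvout⟩, hvmin⟩ := hEc.exists_isLeast ⟨u₀, Ioc_subset_Icc_self hu₀, hout⟩
  have hsv : s < v := by
    refine lt_of_le_of_ne hvI.1 fun hsv => hvout ?_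
    have := hw s ⟨le_rfl, hsT⟩
    rw [add_sub_cancel_right] at this
    rw [← hsv, h.start]
    exact this
  have hbefore : ∀ u ∈ Ico s v, w u = x + b u - b s := fun u hu => by
    refine h.eq_of_forall_mem_ball hD hball hu.1 fun r hr => ?_
    by_contra hr'
    exact absurd (hvmin ⟨⟨hr.1.le, (hr.2.trans hu.2.le).trans hvI.2⟩, hr'⟩)
      (not_le.2 (hr.2.trans_lt hu.2))
  have hv : w v = x + b v - b s := by
    have hne : (𝓝[Ico s v] v).NeBot := by
      rw [← mem_closure_iff_nhdsWithin_neBot, closure_Ico hsv.ne]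
      exact ⟨hsv.le, le_rfl⟩
    refine tendsto_nhds_unique (l := 𝓝[Ico s v] v) (f := w) ?_ ?_
    · exact (h.continuousOn_path v hsv.le).mono_left (nhdsWithin_mono _ fun u hu => hu.1)
    · have hc : Continuous fun u => x + b u - b s := by fun_prop
      refine (hc.continuousAt.continuousWithinAt (s := Ico s v)).congr' ?_
      filter_upwards [self_mem_nhdsWithin] with u hu using (hbefore u hu).symm
  exact hvout (hv ▸ hw v hvI)

end SolvesSkorokhod

/-- The path `w` comes arbitrarily close to `y` at arbitrarily late times. -/
def VisitsLate {d : ℕ} (y : EuclideanSpace ℝ (Fin d)) (w : ℝ≥0 → EuclideanSpace ℝ (Fin d)) : Prop :=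
  ∀ ε : ℝ, 0 < ε → ∀ T : ℝ≥0, ∃ t ≥ T, ‖w t - y‖ < ε

section Recurrence

variable {d : ℕ} {D : ℝ≥0 → Set (EuclideanSpace ℝ (Fin d))} {x y : EuclideanSpace ℝ (Fin d)}
  {w : ℝ≥0 → EuclideanSpace ℝ (Fin d)}

theorem hitTime_lt_iff {ε : ℝ} {a b : ℝ≥0∞} :
    hitTime w y ε a < b ↔ ∃ t : ℝ≥0, a ≤ t ∧ ‖w t - y‖ < ε ∧ (t : ℝ≥0∞) < b := by
  simp only [hitTime, iInf_lt_iff, exists_prop]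

theorem leaveTime_lt_iff {a b : ℝ≥0∞} :
    leaveTime w y a < b ↔ ∃ t : ℝ≥0, a ≤ t ∧ 1 / 2 < ‖w t - y‖ ∧ (t : ℝ≥0∞) < b := by
  simp only [leaveTime, iInf_lt_iff, exists_prop]

theorem le_hitTime {ε : ℝ} {a : ℝ≥0∞} : a ≤ hitTime w y ε a :=
  le_iInf fun _ => le_iInf fun h => le_iInf fun _ => h

theorem le_leaveTime {a : ℝ≥0∞} : a ≤ leaveTime w y a :=
  le_iInf fun _ => le_iInf fun h => le_iInf fun _ => h

/-- A finite first entrance time is a limit of times at which the condition holds. -/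
theorem mem_closure_of_iInf_eq {p : ℝ≥0 → Prop} {a : ℝ≥0∞} {h : ℝ≥0}
    (hh : ⨅ (t : ℝ≥0) (_ : a ≤ t) (_ : p t), (t : ℝ≥0∞) = h) : h ∈ closure {t | p t} := by
  refine Metric.mem_closure_iff.2 fun δ hδ => ?_
  lift δ to ℝ≥0 using hδ.le
  have hlt : ⨅ (t : ℝ≥0) (_ : a ≤ t) (_ : p t), (t : ℝ≥0∞) < (h + δ : ℝ≥0) := by
    rw [hh, ENNReal.coe_lt_coe]
    exact lt_add_of_pos_right _ (NNReal.coe_pos.1 hδ)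
  simp only [iInf_lt_iff, exists_prop, ENNReal.coe_lt_coe] at hlt
  obtain ⟨t, hat, ht, htb⟩ := hlt
  have hle : h ≤ t := by
    rw [← ENNReal.coe_le_coe, ← hh]
    exact iInf_le_of_le t (iInf_le_of_le hat (iInf_le_of_le ht le_rfl))
  refine ⟨t, ht, ?_⟩
  rw [← NNReal.coe_lt_coe, NNReal.coe_add] at htb
  rw [dist_comm, NNReal.dist_eq, abs_of_nonneg (sub_nonneg.2 (NNReal.coe_le_coe.2 hle))]
  linarith

theorem norm_le_of_hitTime (hw : Continuous w) {ε : ℝ} {a : ℝ≥0∞} {h : ℝ≥0}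
    (hh : hitTime w y ε a = h) : ‖w h - y‖ ≤ ε := by
  have hcl : IsClosed {t | ‖w t - y‖ ≤ ε} := isClosed_le (by fun_prop) continuous_const
  have hmem : h ∈ closure {t | ‖w t - y‖ < ε} :=
    mem_closure_of_iInf_eq (p := fun t => ‖w t - y‖ < ε) hh
  have hsub : {t | ‖w t - y‖ < ε} ⊆ {t | ‖w t - y‖ ≤ ε} :=
    fun t ht => le_of_lt (mem_ofPred.1 ht)
  exact closure_minimal hsub hcl hmem

theorem le_norm_of_leaveTime (hw : Continuous w) {a : ℝ≥0∞} {h : ℝ≥0}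
    (hh : leaveTime w y a = h) : 1 / 2 ≤ ‖w h - y‖ := by
  have hcl : IsClosed {t | 1 / 2 ≤ ‖w t - y‖} := isClosed_le continuous_const (by fun_prop)
  have hmem : h ∈ closure {t | 1 / 2 < ‖w t - y‖} :=
    mem_closure_of_iInf_eq (p := fun t => 1 / 2 < ‖w t - y‖) hh
  have hsub : {t | 1 / 2 < ‖w t - y‖} ⊆ {t | 1 / 2 ≤ ‖w t - y‖} :=
    fun t ht => le_of_lt (mem_ofPred.1 ht)
  exact closure_minimal hsub hcl hmem

/-- The domains exhaust the space, because all times `σ⁽⁰⁾` are finite on a recurrent path. -/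
theorem IsXYRecurrent.exists_ball_subset (h : IsXYRecurrent D x y w) (R : ℝ) :
    ∃ t, Metric.ball x R ⊆ D t := by
  have h0 : excursionEnd D x y (max R 1) w 0 < ⊤ :=
    le_hitTime.trans_lt (h.2 (max R 1) (by positivity) 0)
  simp only [excursionEnd, iInf_lt_iff] at h0
  obtain ⟨t, ht, -⟩ := h0
  exact ⟨t, (Metric.ball_subset_ball (le_max_left _ _)).trans ht⟩

/-- Infinitely many excursions of a continuous path cannot take place in a bounded time interval:
at the limit of the excursion times, the path would be both close to `y` and at distance at least
`1 / 2` from it. -/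
theorem IsXYRecurrent.visitsLate (h : IsXYRecurrent D x y w) (hw : Continuous w) :
    VisitsLate y w := by
  intro ε hε T
  set η := min ε (1 / 4)
  have hη : 0 < η := by positivity
  set a := excursionEnd D x y η w with ha
  have hhit : ∀ i, hitTime w y η (a i) < ⊤ := h.2 η hη
  suffices H : ∃ i, (T : ℝ≥0∞) ≤ a i by
    obtain ⟨i, hi⟩ := H
    obtain ⟨t, hat, ht, -⟩ := hitTime_lt_iff.1 (hhit i)
    exact ⟨t, ENNReal.coe_le_coe.1 (hi.trans hat), ht.trans_le (min_le_left _ _)⟩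
  by_contra! hT
  -- otherwise the excursion times converge, while the path oscillates
  have hT' : ∀ i, hitTime w y η (a i) < T := fun i => le_leaveTime.trans_lt (hT (i + 1))
  lift a to ℕ → ℝ≥0 using fun i => (hT i).ne_top with a' ha'
  choose τ hτ using fun i => WithTop.ne_top_iff_exists.1 (hhit i).ne
  replace hτ : ∀ i, (τ i : ℝ≥0∞) = hitTime w y η (a' i) := hτ
  have h1 : ∀ i, a' i ≤ τ i := fun i => by
    rw [← ENNReal.coe_le_coe, hτ]; exact le_hitTime
  have h2' : ∀ i, leaveTime w y (τ i) = a' (i + 1) := fun i => by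
    rw [hτ]
    have := congrFun ha (i + 1)
    rw [excursionEnd, ← congrFun ha i] at this
    exact this.symm
  have h2 : ∀ i, τ i ≤ a' (i + 1) := fun i => by
    rw [← ENNReal.coe_le_coe, ← h2']; exact le_leaveTime
  have hmono : Monotone a' := monotone_nat_of_le_succ fun i => (h1 i).trans (h2 i)
  have hbdd : BddAbove (range a') := ⟨T, by
    rintro - ⟨i, rfl⟩
    exact ENNReal.coe_le_coe.1 (hT i).le⟩
  have hlim := tendsto_atTop_ciSup hmono hbdd
  have hlim' : Tendsto τ atTop (𝓝 (⨆ i, a' i)) :=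
    tendsto_of_tendsto_of_tendsto_of_le_of_le hlim (hlim.comp (tendsto_add_atTop_nat 1)) h1 h2
  have hle : ‖w (⨆ i, a' i) - y‖ ≤ η := by
    have hc : Tendsto (fun i => ‖w (τ i) - y‖) atTop (𝓝 ‖w (⨆ i, a' i) - y‖) :=
      ((hw.tendsto _).comp hlim').sub_const y |>.norm
    exact le_of_tendsto' hc fun i => norm_le_of_hitTime hw (hτ i).symm
  have hge : 1 / 2 ≤ ‖w (⨆ i, a' i) - y‖ := by
    have hc : Tendsto (fun i => ‖w (a' (i + 1)) - y‖) atTop (𝓝 ‖w (⨆ i, a' i) - y‖) :=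
      ((hw.tendsto _).comp (hlim.comp (tendsto_add_atTop_nat 1))).sub_const y |>.norm
    exact ge_of_tendsto' hc fun i => le_norm_of_leaveTime hw (h2' i)
  have : η ≤ 1 / 4 := min_le_right _ _
  linarith

theorem isXYRecurrent_of_visitsLate (h0 : w 0 = x) (hv : VisitsLate y w)
    (hl : ∀ T : ℝ≥0, ∃ t ≥ T, 1 / 2 < ‖w t - y‖) (hD : ∀ R, ∃ t, Metric.ball x R ⊆ D t) :
    IsXYRecurrent D x y w := by
  refine ⟨h0, fun ε hε => ?_⟩
  have hhit : ∀ a : ℝ≥0∞, a < ⊤ → hitTime w y ε a < ⊤ := fun a ha => by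
    obtain ⟨t, ht, htv⟩ := hv ε hε a.toNNReal
    exact hitTime_lt_iff.2 ⟨t, by rw [← ENNReal.coe_toNNReal ha.ne]; exact_mod_cast ht, htv,
      ENNReal.coe_lt_top⟩
  have hleave : ∀ a : ℝ≥0∞, a < ⊤ → leaveTime w y a < ⊤ := fun a ha => by
    obtain ⟨t, ht, htv⟩ := hl a.toNNReal
    exact leaveTime_lt_iff.2 ⟨t, by rw [← ENNReal.coe_toNNReal ha.ne]; exact_mod_cast ht, htv,
      ENNReal.coe_lt_top⟩
  have hend : ∀ i, excursionEnd D x y ε w i < ⊤ := fun i => by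
    induction i with
    | zero =>
      obtain ⟨t, ht⟩ := hD ε
      exact (iInf_le_of_le t (iInf_le _ ht)).trans_lt ENNReal.coe_lt_top
    | succ i ih => exact hleave _ (hhit _ ih)
  exact fun i => hhit _ (hend i)

/-- Restricting a continuous path to a countable dense set of times after `t` does not change
whether it visits every neighbourhood of `y` at arbitrarily late times. -/
theorem visitsLate_iff_denseSeq (hw : Continuous w) (t : ℝ≥0) :
    VisitsLate y w ↔ ∀ n m : ℕ, ∃ q : ℕ, (n : ℝ≥0) ≤ TopologicalSpace.denseSeq ℝ≥0 q ∧
      ‖w (t + TopologicalSpace.denseSeq ℝ≥0 q) - y‖ < 1 / (m + 1) := by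
  constructor
  · intro h n m
    obtain ⟨u, hu, huv⟩ := h (1 / (m + 1)) (by positivity) (t + n + 1)
    have ho : IsOpen {r : ℝ≥0 | (n : ℝ≥0) < r ∧ ‖w (t + r) - y‖ < 1 / (m + 1)} := by
      have hc : Continuous fun r => ‖w (t + r) - y‖ := by fun_prop
      exact (isOpen_lt continuous_const continuous_id).and (isOpen_lt hc continuous_const)
    have hne : {r : ℝ≥0 | (n : ℝ≥0) < r ∧ ‖w (t + r) - y‖ < 1 / (m + 1)}.Nonempty := by
      obtain ⟨r, rfl⟩ := exists_add_of_le hu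
      refine ⟨n + 1 + r, ?_, ?_⟩
      · exact (lt_add_one _).trans_le le_self_add
      · rwa [← add_assoc, ← add_assoc]
    obtain ⟨q, h1, h2⟩ := (TopologicalSpace.denseRange_denseSeq ℝ≥0).exists_mem_open ho hne
    exact ⟨q, h1.le, h2⟩
  · intro h ε hε T
    obtain ⟨n, hn⟩ := exists_nat_ge T
    obtain ⟨m, hm⟩ := exists_nat_one_div_lt hε
    obtain ⟨q, hq, hq'⟩ := h n m
    exact ⟨t + _, (hn.trans hq).trans le_add_self, hq'.trans hm⟩

end Recurrence

/-! ### The Gaussian measure and Lebesgue measure -/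

/-- The standard Gaussian measure on the Euclidean space `ℝ^d`: the product of one-dimensional ones,
transported from the space of functions. -/
noncomputable def gaussianEuclidean (d : ℕ) : Measure (EuclideanSpace ℝ (Fin d)) :=
  (Measure.pi fun _ : Fin d => gaussianReal 0 1).map (WithLp.toLp 2)

theorem withDensity_inv_gaussianPDF :
    (gaussianReal 0 1).withDensity (fun t => (gaussianPDF 0 1 t)⁻¹) = volume := by
  rw [gaussianReal_of_var_ne_zero _ one_ne_zero]
  exact withDensity_inv_same (measurable_gaussianPDF 0 1)
    (Eventually.of_forall fun t => (gaussianPDF_pos 0 one_ne_zero t).ne')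
    (Eventually.of_forall fun t => gaussianPDF_ne_top)

theorem volume_eq_withDensity_gaussianEuclidean (d : ℕ) :
    (volume : Measure (EuclideanSpace ℝ (Fin d)))
      = (gaussianEuclidean d).withDensity fun v => ∏ i, (gaussianPDF 0 1 (v i))⁻¹ := by
  have hm : ∀ i : Fin d, Measurable fun t : ℝ => (gaussianPDF 0 1 t)⁻¹ :=
    fun i => (measurable_gaussianPDF 0 1).inv
  have hpi : (volume : Measure (Fin d → ℝ)) =
      (Measure.pi fun _ : Fin d => gaussianReal 0 1).withDensity
        fun v => ∏ i, (gaussianPDF 0 1 (v i))⁻¹ := by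
    refine Measure.pi_eq fun S hS => ?_
    rw [withDensity_apply _ (MeasurableSet.univ_pi hS),
      ← lintegral_indicator (MeasurableSet.univ_pi hS)]
    have hprod : (Set.univ.pi S).indicator (fun v : Fin d → ℝ => ∏ i, (gaussianPDF 0 1 (v i))⁻¹)
        = fun v => ∏ i, (S i).indicator (fun t => (gaussianPDF 0 1 t)⁻¹) (v i) := by
      funext v
      by_cases hv : v ∈ Set.univ.pi S
      · rw [indicator_of_mem hv]
        exact Finset.prod_congr rfl fun i _ =>
          (indicator_of_mem (hv i (mem_univ i)) (fun t => (gaussianPDF 0 1 t)⁻¹)).symm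
      · rw [indicator_of_notMem hv]
        simp only [mem_univ_pi, not_forall] at hv
        obtain ⟨i, hi⟩ := hv
        exact (Finset.prod_eq_zero (Finset.mem_univ i) (indicator_of_notMem hi _)).symm
    have hind : iIndepFun (fun (i : Fin d) (v : Fin d → ℝ) =>
        (S i).indicator (fun t => (gaussianPDF 0 1 t)⁻¹) (v i))
        (Measure.pi fun _ : Fin d => gaussianReal 0 1) :=
      iIndepFun_pi (X := fun i => (S i).indicator (fun t => (gaussianPDF 0 1 t)⁻¹))
        fun i => ((hm i).indicator (hS i)).aemeasurable
    rw [hprod, lintegral_prod_eq_prod_lintegral_of_indepFun Finset.univ _ hind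
      fun i => ((hm i).indicator (hS i)).comp (measurable_pi_apply i)]
    refine Finset.prod_congr rfl fun i _ => ?_
    rw [(measurePreserving_eval (fun _ : Fin d => gaussianReal 0 1) i).lintegral_comp
      ((hm i).indicator (hS i)), lintegral_indicator (hS i), ← withDensity_apply _ (hS i),
      withDensity_inv_gaussianPDF]
  have hmp := PiLp.volume_preserving_toLp (Fin d)
  ext S hS
  rw [← hmp.measure_preimage hS.nullMeasurableSet, hpi,
    withDensity_apply _ (hmp.measurable hS), withDensity_apply _ hS, gaussianEuclidean,
    setLIntegral_map hS ?_ hmp.measurable]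
  exact Finset.measurable_prod _ fun i _ => (hm i).comp (by fun_prop)

theorem gaussianEuclidean_absolutelyContinuous (d : ℕ) : gaussianEuclidean d ≪ volume := by
  rw [volume_eq_withDensity_gaussianEuclidean d]
  refine withDensity_absolutelyContinuous' ?_ (Eventually.of_forall fun v => ?_)
  · exact (Finset.measurable_prod _ fun i _ =>
      (measurable_gaussianPDF 0 1).inv.comp (by fun_prop)).aemeasurable
  · exact Finset.prod_ne_zero_iff.2 fun i _ => ENNReal.inv_ne_zero.2 gaussianPDF_ne_top

theorem exists_mul_volume_le_gaussianEuclidean (d : ℕ) (R : ℝ) :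
    ∃ m : ℝ≥0∞, m ≠ 0 ∧ ∀ S : Set (EuclideanSpace ℝ (Fin d)), MeasurableSet S →
      S ⊆ Metric.ball 0 R → m * volume S ≤ gaussianEuclidean d S := by
  set M : ℝ≥0∞ := ∏ _i : Fin d, (gaussianPDF 0 1 R)⁻¹ with hM
  have hMtop : M ≠ ⊤ := ENNReal.prod_ne_top fun i _ =>
    ENNReal.inv_ne_top.2 (gaussianPDF_pos 0 one_ne_zero R).ne'
  have hM0 : M ≠ 0 := Finset.prod_ne_zero_iff.2 fun i _ => ENNReal.inv_ne_zero.2 gaussianPDF_ne_top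
  refine ⟨M⁻¹, ENNReal.inv_ne_zero.2 hMtop, fun S hS hSR => ?_⟩
  rw [ENNReal.inv_mul_le_iff hM0 hMtop, volume_eq_withDensity_gaussianEuclidean d,
    withDensity_apply _ hS, ← setLIntegral_const]
  refine setLIntegral_mono measurable_const fun v hv => Finset.prod_le_prod' fun i _ => ?_
  rw [ENNReal.inv_le_inv, gaussianPDF, gaussianPDF, gaussianPDFReal, gaussianPDFReal]
  refine ENNReal.ofReal_le_ofReal ?_
  have hvR : ‖v i‖ ≤ R := (PiLp.norm_apply_le v i).trans (mem_ball_zero_iff.1 (hSR hv)).le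
  rw [Real.norm_eq_abs] at hvR
  have hsq : (v i - 0) ^ 2 ≤ (R - 0) ^ 2 := by
    rw [sub_zero, sub_zero, ← sq_abs (v i)]
    gcongr
  gcongr

theorem volume_preimage_smul_add {d : ℕ} (c : ℝ≥0) (hc : c ≠ 0)
    (x : EuclideanSpace ℝ (Fin d)) (N : Set (EuclideanSpace ℝ (Fin d))) :
    volume ((fun v => √(c : ℝ) • v) ⁻¹' ((fun v => x + v) ⁻¹' N))
      = ENNReal.ofReal ((√(c : ℝ) ^ d)⁻¹) * volume N := by
  have hc0 : 0 < √(c : ℝ) := Real.sqrt_pos.2 (NNReal.coe_pos.2 (pos_iff_ne_zero.2 hc))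
  rw [Measure.addHaar_preimage_smul _ hc0.ne', measure_preimage_add, finrank_euclideanSpace_fin,
    abs_of_pos (by positivity)]

/-! ### Uniform lower bound for interior transition probabilities -/

section Real

variable {Ω : Type*} [MeasurableSpace Ω] {P : Measure Ω} {B B' : ℝ≥0 → Ω → ℝ}

/-- Countable suprema of Brownian motion are determined by the finite-dimensional distributions. -/
theorem IsPreBrownianReal.measure_exists_lt_abs_eq (hB : IsPreBrownianReal B P)
    (hB' : IsPreBrownianReal B' P) (r : ℕ → ℝ≥0) (lam : ℝ) :
    P {ω | ∃ k, lam < |B (r k) ω|} = P {ω | ∃ k, lam < |B' (r k) ω|} := by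
  classical
  let J : ℕ → Finset ℝ≥0 := fun n => (Finset.range n).image r
  have key : ∀ {C : ℝ≥0 → Ω → ℝ}, IsPreBrownianReal C P → P {ω | ∃ k, lam < |C (r k) ω|}
      = ⨆ n, BrownianReal.projectiveFamily (J n) {p | ∃ i, lam < |p i|} := by
    intro C hC
    have hU : {ω | ∃ k, lam < |C (r k) ω|} = ⋃ n, {ω | ∃ i ∈ J n, lam < |C i ω|} := by
      ext ω
      simp only [mem_ofPred_eq, mem_iUnion, J, Finset.mem_image, Finset.mem_range]
      constructor
      · rintro ⟨k, hk⟩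
        exact ⟨k + 1, r k, ⟨k, Nat.lt_succ_self k, rfl⟩, hk⟩
      · rintro ⟨n, -, ⟨k, -, rfl⟩, hk⟩
        exact ⟨k, hk⟩
    have hmono : Monotone fun n => {ω | ∃ i ∈ J n, lam < |C i ω|} := by
      rintro n m hnm ω ⟨i, hi, hlt⟩
      exact ⟨i, Finset.image_subset_image (Finset.range_mono hnm) hi, hlt⟩
    rw [hU, hmono.measure_iUnion]
    refine iSup_congr fun n => ?_
    have hS : MeasurableSet {p : J n → ℝ | ∃ i, lam < |p i|} := by
      simp only [ofPred_exists]
      exact MeasurableSet.iUnion fun i => measurableSet_lt measurable_const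
        (measurable_pi_apply i).abs
    rw [← (hC.hasLaw (J n)).map_eq,
      Measure.map_apply_of_aemeasurable (hC.hasLaw (J n)).aemeasurable hS]
    congr 1
    ext ω
    simp
  rw [key hB, key hB']

/-- The running maximum of Brownian motion over the time interval `[0, 1]` has a tail bound that
holds for all Brownian motions at once. -/
theorem IsBrownianReal.exists_forall_measure_le (hB : IsBrownianReal B P)
    (hm : ∀ t, Measurable (B t)) {δ : ℝ≥0∞} (hδ : δ ≠ 0) :
    ∃ lam : ℝ, 0 < lam ∧ ∀ B' : ℝ≥0 → Ω → ℝ, IsBrownianReal B' P →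
      P {ω | ∃ r ≤ 1, lam ≤ |B' r ω|} ≤ δ := by
  have : IsProbabilityMeasure P := hB.isGaussianProcess.isProbabilityMeasure
  let r : ℕ → ℝ≥0 := fun k => min (TopologicalSpace.denseSeq ℝ≥0 k) 1
  let E : ℕ → Set Ω := fun n => {ω | ∃ k, (n : ℝ) < |B (r k) ω|}
  have hE : ∀ n, MeasurableSet (E n) := fun n => by
    simp only [E, ofPred_exists]
    exact MeasurableSet.iUnion fun k => measurableSet_lt measurable_const (hm _).abs
  have hanti : Antitone E := by
    rintro n m hnm ω ⟨k, hk⟩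
    exact ⟨k, lt_of_le_of_lt (Nat.cast_le.2 hnm) hk⟩
  have hnull : P (⋂ n, E n) = 0 := by
    rw [measure_eq_zero_iff_ae_notMem]
    filter_upwards [hB.cont] with ω hω hmem
    obtain ⟨C, hC⟩ := (isCompact_Icc (a := (0 : ℝ≥0)) (b := 1)).exists_bound_of_continuousOn
      hω.continuousOn
    obtain ⟨n, hn⟩ := exists_nat_ge C
    obtain ⟨k, hk⟩ := mem_iInter.1 hmem n
    exact absurd (hC (r k) ⟨zero_le, min_le_right _ _⟩) (not_le.2 (hn.trans_lt hk))
  have hlim : Tendsto (fun n => P (E n)) atTop (𝓝 0) := by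
    rw [← hnull]
    exact tendsto_measure_iInter_atTop (fun n => (hE n).nullMeasurableSet) hanti
      ⟨0, measure_ne_top _ _⟩
  obtain ⟨n, hn⟩ := (hlim.eventually (ge_mem_nhds (pos_iff_ne_zero.2 hδ))).exists
  refine ⟨n + 1, by positivity, fun B' hB' => ?_⟩
  refine le_trans ?_ ((IsPreBrownianReal.measure_exists_lt_abs_eq hB'.toIsPreBrownianReal
    hB.toIsPreBrownianReal r n).le.trans hn)
  refine measure_mono_ae ?_
  filter_upwards [hB'.cont] with ω hω
  rintro ⟨t, ht, hlt⟩
  have hc : Continuous fun u => |B' (min u 1) ω| := by fun_prop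
  obtain ⟨k, hk⟩ := (TopologicalSpace.denseRange_denseSeq ℝ≥0).exists_mem_open
    (isOpen_lt continuous_const hc : IsOpen {u | (n : ℝ) < |B' (min u 1) ω|})
    ⟨t, by
      rw [mem_ofPred_eq, min_eq_left ht]
      linarith⟩
  exact ⟨k, hk⟩

end Real

namespace IsBrownianMotion

variable {d : ℕ} {Ω : Type*} [MeasurableSpace Ω] {P : Measure Ω}
  {U : ℝ≥0 → Ω → EuclideanSpace ℝ (Fin d)}

theorem ae_continuous (hU : IsBrownianMotion U P) : ∀ᵐ ω ∂P, Continuous fun t => U t ω := by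
  filter_upwards [ae_all_iff.2 fun i => (hU.coord i).cont] with ω hω
  exact (PiLp.continuous_toLp 2 _).comp (continuous_pi hω)

/-- The rescaled increments are standard Gaussian. -/
theorem map_increment (hU : IsBrownianMotion U P) [IsProbabilityMeasure P] (s : ℝ≥0) {c : ℝ≥0}
    (hc : c ≠ 0) :
    P.map (fun ω => (√(c : ℝ))⁻¹ • (U (s + c) ω - U s ω)) = gaussianEuclidean d := by
  let g : Fin d → (ℝ≥0 → ℝ) → ℝ := fun _ p => (√(c : ℝ))⁻¹ * (p (s + c) - p s)
  have hg : ∀ i, Measurable (g i) := fun i => by fun_prop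
  have hind := hU.indep.comp g hg
  have hcoord : ∀ (i : Fin d) (t : ℝ≥0), Measurable fun ω => U t ω i := fun i t =>
    (EuclideanSpace.proj i : EuclideanSpace ℝ (Fin d) →L[ℝ] ℝ).continuous.measurable.comp
      (hU.measurable t)
  have hgm : ∀ i, Measurable fun ω => g i (fun t => U t ω i) := fun i =>
    (hg i).comp (measurable_pi_lambda _ (hcoord i))
  have hlaw : ∀ i, P.map (fun ω => g i (fun t => U t ω i)) = gaussianReal 0 1 := fun i => by
    have := ((((hU.coord i).shift s).smul hc).hasLaw_eval 1).map_eq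
    rw [mul_one] at this
    exact this
  have hpi := (iIndepFun_iff_map_fun_eq_pi_map fun i => (hgm i).aemeasurable).1 hind
  simp only [hlaw] at hpi
  rw [gaussianEuclidean, ← hpi, Measure.map_map (by fun_prop) (measurable_pi_lambda _ hgm)]
  rfl

theorem measure_increment_mem (hU : IsBrownianMotion U P) [IsProbabilityMeasure P] (s : ℝ≥0)
    {c : ℝ≥0} (hc : c ≠ 0) (x : EuclideanSpace ℝ (Fin d)) {N : Set (EuclideanSpace ℝ (Fin d))}
    (hN : MeasurableSet N) :
    P {ω | x + U (s + c) ω - U s ω ∈ N}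
      = gaussianEuclidean d ((fun v => √(c : ℝ) • v) ⁻¹' ((fun v => x + v) ⁻¹' N)) := by
  have hc0 : √(c : ℝ) ≠ 0 := (Real.sqrt_pos.2 (NNReal.coe_pos.2 (pos_iff_ne_zero.2 hc))).ne'
  have hm : Measurable fun ω => (√(c : ℝ))⁻¹ • (U (s + c) ω - U s ω) := by
    have h1 := hU.measurable (s + c)
    have h2 := hU.measurable s
    fun_prop
  rw [← hU.map_increment s hc, Measure.map_apply hm]
  · congr 1
    ext ω
    simp only [mem_ofPred_eq, mem_preimage, smul_inv_smul₀ hc0, add_sub_assoc]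
  · exact (measurable_const_smul _) ((measurable_const_add x) hN)

theorem measure_increment_mem_eq_zero (hU : IsBrownianMotion U P) [IsProbabilityMeasure P]
    (s : ℝ≥0) {c : ℝ≥0} (hc : c ≠ 0) (x : EuclideanSpace ℝ (Fin d))
    {N : Set (EuclideanSpace ℝ (Fin d))} (hN : MeasurableSet N) (hN0 : volume N = 0) :
    P {ω | x + U (s + c) ω - U s ω ∈ N} = 0 := by
  rw [hU.measure_increment_mem s hc x hN]
  refine gaussianEuclidean_absolutelyContinuous d ?_
  rw [volume_preimage_smul_add c hc, hN0, mul_zero]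

/-- At the scale `√c` of its time step, Brownian motion reaches any set that fills a given
proportion of a ball of radius `√c` with a probability bounded below, uniformly in position and
scale. -/
theorem exists_le_measure_increment_mem (hU : IsBrownianMotion U P) [IsProbabilityMeasure P]
    {θ : ℝ} (hθ : 0 < θ) :
    ∃ m : ℝ≥0∞, m ≠ 0 ∧ ∀ (s c : ℝ≥0) (a x : EuclideanSpace ℝ (Fin d))
      (N : Set (EuclideanSpace ℝ (Fin d))), c ≠ 0 → x ∈ Metric.ball a (√(c : ℝ)) →
      N ⊆ Metric.ball a (√(c : ℝ)) → MeasurableSet N →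
      ENNReal.ofReal (θ * √(c : ℝ) ^ d) ≤ volume N →
      m ≤ P {ω | x + U (s + c) ω - U s ω ∈ N} := by
  obtain ⟨m, hm0, hm⟩ := exists_mul_volume_le_gaussianEuclidean d 2
  refine ⟨m * ENNReal.ofReal θ, mul_ne_zero hm0 (ENNReal.ofReal_pos.2 hθ).ne',
    fun s c a x N hc hx hNa hN hvol => ?_⟩
  have hc0 : 0 < √(c : ℝ) := Real.sqrt_pos.2 (NNReal.coe_pos.2 (pos_iff_ne_zero.2 hc))
  rw [hU.measure_increment_mem s hc x hN]
  refine le_trans ?_ (hm _ ((measurable_const_smul _) ((measurable_const_add x) hN)) ?_)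
  · gcongr
    rw [volume_preimage_smul_add c hc]
    calc ENNReal.ofReal θ
        = ENNReal.ofReal ((√(c : ℝ) ^ d)⁻¹) * ENNReal.ofReal (θ * √(c : ℝ) ^ d) := by
          rw [← ENNReal.ofReal_mul (by positivity)]
          congr 1
          field_simp
      _ ≤ _ := by gcongr
  · intro v hv
    have h1 : ‖x + √(c : ℝ) • v - a‖ < √(c : ℝ) := mem_ball_iff_norm.1 (hNa hv)
    have h2 : ‖x - a‖ < √(c : ℝ) := mem_ball_iff_norm.1 hx
    have h3 : ‖√(c : ℝ) • v‖ < 2 * √(c : ℝ) := by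
      calc ‖√(c : ℝ) • v‖ = ‖(x + √(c : ℝ) • v - a) - (x - a)‖ := by congr 1; abel
        _ ≤ ‖x + √(c : ℝ) • v - a‖ + ‖x - a‖ := norm_sub_le _ _
        _ < _ := by linarith
    rw [norm_smul, Real.norm_of_nonneg hc0.le, mul_comm] at h3
    exact mem_ball_zero_iff.2 (lt_of_mul_lt_mul_right h3 hc0.le)

/-- The displacement of Brownian motion over a time step `c` exceeds a large multiple of `√c` with a
small probability, uniformly in the scale. -/
theorem exists_measure_increment_tail (hU : IsBrownianMotion U P) [IsProbabilityMeasure P]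
    {δ : ℝ≥0∞} (hδ : δ ≠ 0) :
    ∃ lam : ℝ, 0 < lam ∧ ∀ s c : ℝ≥0, c ≠ 0 →
      P {ω | ∃ u ∈ Icc s (s + c), lam * √(c : ℝ) ≤ ‖U u ω - U s ω‖} ≤ δ := by
  rcases isEmpty_or_nonempty (Fin d) with hd | ⟨⟨i₀⟩⟩
  · refine ⟨1, one_pos, fun s c hc => ?_⟩
    have hc0 : 0 < √(c : ℝ) := Real.sqrt_pos.2 (NNReal.coe_pos.2 (pos_iff_ne_zero.2 hc))
    have hempty : {ω | ∃ u ∈ Icc s (s + c), 1 * √(c : ℝ) ≤ ‖U u ω - U s ω‖} = ∅ := by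
      rw [eq_empty_iff_forall_notMem]
      rintro ω ⟨u, -, hu⟩
      rw [Subsingleton.elim (U u ω - U s ω) 0, norm_zero] at hu
      linarith
    rw [hempty, measure_empty]
    exact zero_le
  have hδ' : δ / d ≠ 0 := (ENNReal.div_pos hδ (ENNReal.natCast_ne_top d)).ne'
  have hcoord : ∀ t, Measurable fun ω => U t ω i₀ := fun t =>
    (EuclideanSpace.proj i₀ : EuclideanSpace ℝ (Fin d) →L[ℝ] ℝ).continuous.measurable.comp
      (hU.measurable t)
  obtain ⟨lam, hlam, hbound⟩ := IsBrownianReal.exists_forall_measure_le (hU.coord i₀) hcoord hδ'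
  have hd : 0 < d := i₀.pos
  refine ⟨d * lam, by positivity, fun s c hc => ?_⟩
  have hc0 : 0 < √(c : ℝ) := Real.sqrt_pos.2 (NNReal.coe_pos.2 (pos_iff_ne_zero.2 hc))
  calc P {ω | ∃ u ∈ Icc s (s + c), d * lam * √(c : ℝ) ≤ ‖U u ω - U s ω‖}
      ≤ P (⋃ i : Fin d, {ω | ∃ r ≤ 1, lam ≤ |(√(c : ℝ))⁻¹ * (U (s + c * r) ω i - U s ω i)|}) := by
        refine measure_mono ?_
        rintro ω ⟨u, ⟨hsu, huc⟩, hu⟩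
        obtain ⟨v, rfl⟩ := exists_add_of_le hsu
        have hvc : v ≤ c := le_of_add_le_add_left huc
        obtain ⟨i, -, hi⟩ : ∃ i ∈ Finset.univ,
            lam * √(c : ℝ) ≤ ‖(U (s + v) ω - U s ω) i‖ := by
          by_contra! hlt
          have h1 : ‖U (s + v) ω - U s ω‖ ≤ ∑ i, ‖(U (s + v) ω - U s ω) i‖ := by
            rw [EuclideanSpace.norm_eq]
            exact Real.sqrt_le_iff.2 ⟨by positivity,
              Finset.sum_sq_le_sq_sum_of_nonneg fun i _ => norm_nonneg _⟩
          have h2 : ∑ i, ‖(U (s + v) ω - U s ω) i‖ < ∑ _i : Fin d, lam * √(c : ℝ) :=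
            Finset.sum_lt_sum_of_nonempty ⟨i₀, Finset.mem_univ _⟩ fun i hi => hlt i hi
          rw [Finset.sum_const, Finset.card_univ, Fintype.card_fin, nsmul_eq_mul] at h2
          linarith
        refine mem_iUnion.2 ⟨i, v / c, ?_, ?_⟩
        · exact div_le_one_of_le₀ hvc zero_le
        · rw [mul_div_cancel₀ _ hc, abs_mul, abs_of_pos (inv_pos.2 hc0), ← div_eq_inv_mul,
            le_div_iff₀ hc0]
          exact hi
    _ ≤ ∑' i : Fin d, P {ω | ∃ r ≤ 1, lam ≤ |(√(c : ℝ))⁻¹ * (U (s + c * r) ω i - U s ω i)|} :=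
        measure_iUnion_le _
    _ ≤ ∑' _i : Fin d, δ / d :=
        ENNReal.tsum_le_tsum fun i => hbound _ (((hU.coord i).shift s).smul hc)
    _ ≤ δ := by
        rw [tsum_fintype, Finset.sum_const, Finset.card_univ, Fintype.card_fin, nsmul_eq_mul]
        exact ENNReal.mul_div_le

end IsBrownianMotion

namespace IsRBMG

variable {d : ℕ} {Ω : Type*} [MeasurableSpace Ω] {P : Measure Ω} [IsProbabilityMeasure P]
  {D : ℝ≥0 → Set (EuclideanSpace ℝ (Fin d))} {U : ℝ≥0 → Ω → EuclideanSpace ℝ (Fin d)}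
  {W : ℝ≥0 → EuclideanSpace ℝ (Fin d) → ℝ≥0 → Ω → EuclideanSpace ℝ (Fin d)}
  {L : ℝ≥0 → EuclideanSpace ℝ (Fin d) → ℝ≥0 → Ω → ℝ}

/-- The uniform lower bound for the interior transition probabilities: as long as the domain
contains a ball of radius `K * √c` around `a`, the reflected process from a point of the ball of
radius `√c` reaches within time `c` any set that fills a given proportion of this ball, with a
probability that does not depend on position, time or scale. With high probability the driver does
not leave the large ball, and then the reflected process agrees with it. -/
theorem exists_le_measure_mem (h : IsRBMG D U P W L) {θ : ℝ} (hθ : 0 < θ) :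
    ∃ K : ℝ, 1 < K ∧ ∃ m : ℝ≥0∞, m ≠ 0 ∧ ∀ (s c : ℝ≥0) (a x : EuclideanSpace ℝ (Fin d))
      (N : Set (EuclideanSpace ℝ (Fin d))), c ≠ 0 → Metric.ball a (K * √(c : ℝ)) ⊆ D s →
      x ∈ Metric.ball a (√(c : ℝ)) → N ⊆ Metric.ball a (√(c : ℝ)) → MeasurableSet N →
      ENNReal.ofReal (θ * √(c : ℝ) ^ d) ≤ volume N →
      m ≤ P {ω | W s x (s + c) ω ∈ N} := by
  obtain ⟨m, hm0, hm⟩ := h.brownian.exists_le_measure_increment_mem hθ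
  obtain ⟨lam, hlam, htail⟩ := h.brownian.exists_measure_increment_tail
    (ENNReal.half_pos hm0).ne'
  -- the driver reaches `N` with probability at least `m`, and leaves the ball of radius
  -- `(lam + 1) * √c` with probability at most `m / 2`
  refine ⟨lam + 1, by linarith, m / 2, (ENNReal.half_pos hm0).ne',
    fun s c a x N hc hball hx hNa hN hvol => ?_⟩
  have hc0 : 0 < √(c : ℝ) := Real.sqrt_pos.2 (NNReal.coe_pos.2 (pos_iff_ne_zero.2 hc))
  have hxD : (s, x) ∈ closure (timeSpace D) := subset_closure
    (hball (Metric.ball_subset_ball (by nlinarith) hx) : x ∈ D s)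
  have hmain : m ≤ P {ω | W s x (s + c) ω ∈ N} + m / 2 := by
    calc m ≤ P {ω | x + U (s + c) ω - U s ω ∈ N} := hm s c a x N hc hx hNa hN hvol
      _ ≤ P ({ω | W s x (s + c) ω ∈ N} ∪
          {ω | ∃ u ∈ Icc s (s + c), lam * √(c : ℝ) ≤ ‖U u ω - U s ω‖}) := by
        refine measure_mono_ae ?_
        filter_upwards [(h.solution s x hxD).solves, h.brownian.ae_continuous]
          with ω hsol hcont hmem
        by_cases hbad : ∃ u ∈ Icc s (s + c), lam * √(c : ℝ) ≤ ‖U u ω - U s ω‖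
        · exact Or.inr hbad
        push Not at hbad
        refine Or.inl ?_
        have := hsol.eq_of_driver_mem_ball h.monotone hball le_self_add hcont fun u hu => by
          rw [mem_ball_iff_norm]
          calc ‖x + U u ω - U s ω - a‖ = ‖(U u ω - U s ω) + (x - a)‖ := by congr 1; abel
            _ ≤ ‖U u ω - U s ω‖ + ‖x - a‖ := norm_add_le _ _
            _ < lam * √(c : ℝ) + √(c : ℝ) := add_lt_add (hbad u hu) (mem_ball_iff_norm.1 hx)
            _ = _ := by ring
        change W s x (s + c) ω ∈ N
        rw [this]
        exact hmem
      _ ≤ _ := (measure_union_le _ _).trans (by gcongr; exact htail s c hc)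
  by_cases hmt : m = ⊤
  · exfalso
    have h1 := hm s c a x N hc hx hNa hN hvol
    rw [hmt] at h1
    exact absurd (h1.trans prob_le_one) (by simp)
  · refine (ENNReal.add_le_add_iff_right (ENNReal.div_ne_top hmt two_ne_zero)).1 ?_
    rwa [ENNReal.add_halves]

end IsRBMG

/-! ### Recurrence of reflected Brownian motion does not depend on the point -/

instance isRightContinuous_minimalFiltration {d : ℕ} {Ω : Type*} [MeasurableSpace Ω]
    (U : ℝ≥0 → Ω → EuclideanSpace ℝ (Fin d)) (P : Measure Ω) :
    (minimalFiltration U P).IsRightContinuous := by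
  unfold minimalFiltration
  infer_instance

/-- The first time after `a`, among the times of a fixed countable dense set, at which the path `w`
is in `B`. Using countably many times makes this a stopping time for a merely adapted process. -/
noncomputable def denseHitTime {E : Type*} (B : Set E) (a : ℝ≥0) (w : ℝ≥0 → E) : ℝ≥0∞ :=
  ⨅ (t : ℝ≥0) (_ : (a : ℝ≥0∞) ≤ t) (_ : t ∈ range (TopologicalSpace.denseSeq ℝ≥0) ∧ w t ∈ B),
    (t : ℝ≥0∞)

section DenseHitTime

variable {E : Type*} {B : Set E} {a : ℝ≥0} {w : ℝ≥0 → E}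

theorem denseHitTime_lt_iff {b : ℝ≥0∞} : denseHitTime B a w < b ↔
    ∃ q : ℕ, a ≤ TopologicalSpace.denseSeq ℝ≥0 q ∧ (TopologicalSpace.denseSeq ℝ≥0 q : ℝ≥0∞) < b ∧
      w (TopologicalSpace.denseSeq ℝ≥0 q) ∈ B := by
  simp only [denseHitTime, iInf_lt_iff, exists_prop, ENNReal.coe_le_coe]
  constructor
  · rintro ⟨t, h1, ⟨⟨q, rfl⟩, h2⟩, h3⟩
    exact ⟨q, h1, h3, h2⟩
  · rintro ⟨q, h1, h3, h2⟩
    exact ⟨_, h1, ⟨⟨q, rfl⟩, h2⟩, h3⟩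

theorem le_denseHitTime : (a : ℝ≥0∞) ≤ denseHitTime B a w :=
  le_iInf fun _ => le_iInf fun h => le_iInf fun _ => h

theorem exists_denseSeq_mem [TopologicalSpace E] (hw : Continuous w) (hB : IsOpen B) {t : ℝ≥0}
    (hat : a < t) (ht : w t ∈ B) : ∃ q : ℕ, a ≤ TopologicalSpace.denseSeq ℝ≥0 q ∧
      w (TopologicalSpace.denseSeq ℝ≥0 q) ∈ B := by
  obtain ⟨q, h1, h2⟩ := (TopologicalSpace.denseRange_denseSeq ℝ≥0).exists_mem_open
    (isOpen_Ioi.inter (hB.preimage hw)) ⟨t, hat, ht⟩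
  exact ⟨q, le_of_lt h1, h2⟩

theorem mem_closure_of_denseHitTime [TopologicalSpace E] (hw : Continuous w)
    (hne : denseHitTime B a w ≠ ⊤) : w (denseHitTime B a w).toNNReal ∈ closure B := by
  have h1 := mem_closure_of_iInf_eq
    (p := fun t => t ∈ range (TopologicalSpace.denseSeq ℝ≥0) ∧ w t ∈ B)
    (a := a) (h := (denseHitTime B a w).toNNReal) (ENNReal.coe_toNNReal hne).symm
  refine map_mem_closure hw h1 fun t ht => ht.2

theorem isStoppingTime_denseHitTime {Ω : Type*} [MeasurableSpace E] {m : MeasurableSpace Ω}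
    {f : Filtration ℝ≥0 m} [f.IsRightContinuous] {X : ℝ≥0 → Ω → E}
    (hX : ∀ t, Measurable[f t] (X t)) (hB : MeasurableSet B) (a : ℝ≥0) :
    IsStoppingTime f (fun ω => (denseHitTime B a (fun t => X t ω) : WithTop ℝ≥0)) := by
  refine isStoppingTime_of_measurableSet_lt_of_isRightContinuous fun i => ?_
  have : {ω | (denseHitTime B a (fun t => X t ω) : WithTop ℝ≥0) < i}
      = ⋃ (q : ℕ) (_ : a ≤ TopologicalSpace.denseSeq ℝ≥0 q)
        (_ : TopologicalSpace.denseSeq ℝ≥0 q < i), X (TopologicalSpace.denseSeq ℝ≥0 q) ⁻¹' B := by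
    ext ω
    simp only [mem_iUnion, mem_preimage, exists_prop]
    refine denseHitTime_lt_iff.trans ?_
    simp only [ENNReal.coe_lt_coe]
  exact Eq.mpr (congrArg (fun s => MeasurableSet[f i] s) this)
    (MeasurableSet.iUnion fun q => MeasurableSet.iUnion fun _ => MeasurableSet.iUnion fun hq =>
      f.mono hq.le _ (hX _ hB))

end DenseHitTime

namespace IsRBMG

variable {d : ℕ} {Ω : Type*} [MeasurableSpace Ω] {P : Measure Ω}
  {D : ℝ≥0 → Set (EuclideanSpace ℝ (Fin d))} {U : ℝ≥0 → Ω → EuclideanSpace ℝ (Fin d)}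
  {W : ℝ≥0 → EuclideanSpace ℝ (Fin d) → ℝ≥0 → Ω → EuclideanSpace ℝ (Fin d)}
  {L : ℝ≥0 → EuclideanSpace ℝ (Fin d) → ℝ≥0 → Ω → ℝ} {x : EuclideanSpace ℝ (Fin d)}

theorem adapted (h : IsRBMG D U P W L) (hx : (0, x) ∈ closure (timeSpace D)) (t : ℝ≥0) :
    Measurable[minimalFiltration U P t] (W 0 x t) :=
  (h.solution 0 x hx).adapted_path t zero_le

theorem measurable_path (h : IsRBMG D U P W L) (hx : (0, x) ∈ closure (timeSpace D)) (t : ℝ≥0) :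
    Measurable (W 0 x t) :=
  (h.adapted hx t).mono ((minimalFiltration U P).le t) le_rfl

theorem ae_continuous (h : IsRBMG D U P W L) (hx : (0, x) ∈ closure (timeSpace D)) :
    ∀ᵐ ω ∂P, Continuous fun t => W 0 x t ω := by
  filter_upwards [(h.solution 0 x hx).solves] with ω hω
  have := hω.continuousOn_path
  rwa [show Ici (0 : ℝ≥0) = univ from Ici_bot, continuousOn_univ] at this

theorem ae_start (h : IsRBMG D U P W L) (hx : (0, x) ∈ closure (timeSpace D)) :
    ∀ᵐ ω ∂P, W 0 x 0 ω = x := by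
  filter_upwards [(h.solution 0 x hx).solves] with ω hω using hω.start

/-- A path that returns to the unit ball around `y` at arbitrarily late times also enters the ball
of radius `ε` around `y'` late: at each first return after a time at which the domain contains a
large ball, it does so after a fixed delay `ρ ^ 2` with a probability bounded below. -/
theorem ae_visits_of_visits [IsProbabilityMeasure P] (h : IsRBMG D U P W L)
    (hx : (0, x) ∈ closure (timeSpace D)) (hexh : ∀ R : ℝ, ∃ t, Metric.ball x R ⊆ D t)
    (y y' : EuclideanSpace ℝ (Fin d)) {ε : ℝ} (hε : 0 < ε) (n : ℕ) :
    ∀ᵐ ω ∂P, (∀ T : ℝ≥0, ∃ t ≥ T, ‖W 0 x t ω - y‖ < 1) → ∃ t ≥ (n : ℝ≥0), ‖W 0 x t ω - y'‖ < ε := by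
  -- the target and the closed unit ball around `y` lie in the ball of radius `ρ` around `y`
  obtain ⟨ρ, hρv⟩ : ∃ ρ : ℝ≥0, (ρ : ℝ) = 2 + ‖y' - y‖ + ε :=
    CanLift.prf (2 + ‖y' - y‖ + ε) (by positivity : 0 ≤ 2 + ‖y' - y‖ + ε)
  have hρ0 : (0 : ℝ) < ρ := by rw [hρv]; positivity
  have hsq : √((ρ ^ 2 : ℝ≥0) : ℝ) = ρ := by
    rw [NNReal.coe_pow, Real.sqrt_sq ρ.coe_nonneg]
  have hc : ρ ^ 2 ≠ 0 := pow_ne_zero _ (NNReal.coe_pos.1 hρ0).ne'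
  set N := Metric.ball y' ε with hN
  have hNsub : N ⊆ Metric.ball y ρ := by
    refine Metric.ball_subset_ball' ?_
    rw [dist_eq_norm, hρv]; linarith
  have hNpos : 0 < volume N := Metric.measure_ball_pos _ _ hε
  have hNtop : volume N ≠ ⊤ := measure_ball_lt_top.ne
  have hθ : 0 < (volume N).toReal / ρ ^ d :=
    div_pos (ENNReal.toReal_pos hNpos.ne' hNtop) (by positivity)
  obtain ⟨K, hK, m, hm0, hkey⟩ := h.exists_le_measure_mem hθ
  obtain ⟨T₀, hT₀⟩ := hexh (K * ρ + ‖y - x‖)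
  have hballT : Metric.ball y (K * ρ) ⊆ D T₀ :=
    (Metric.ball_subset_ball' (by rw [dist_eq_norm])).trans hT₀
  obtain ⟨N₁, hN₁⟩ := exists_nat_ge T₀
  set N₀ : ℕ := max N₁ n
  have hT₀N : ∀ k : ℕ, T₀ ≤ ((N₀ + k : ℕ) : ℝ≥0) := fun k =>
    hN₁.trans (Nat.cast_le.2 ((le_max_left _ _).trans (Nat.le_add_right _ _)))
  have hnN : ∀ k : ℕ, (n : ℝ≥0) ≤ ((N₀ + k : ℕ) : ℝ≥0) := fun k =>
    Nat.cast_le.2 ((le_max_right _ _).trans (Nat.le_add_right _ _))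
  let r := TopologicalSpace.denseSeq ℝ≥0
  let B := Metric.ball y 1
  let τ : ℕ → Ω → WithTop ℝ≥0 := fun k ω =>
    (denseHitTime B ((N₀ + k : ℕ) : ℝ≥0) (fun t => W 0 x t ω) : WithTop ℝ≥0)
  have hτ : ∀ k, IsStoppingTime (minimalFiltration U P) (τ k) := fun k =>
    isStoppingTime_denseHitTime (h.adapted hx) Metric.isOpen_ball.measurableSet _
  have hτle : ∀ k ω, (((N₀ + k : ℕ) : ℝ≥0) : WithTop ℝ≥0) ≤ τ k ω := fun k ω => le_denseHitTime
  -- `A k`: the path has not been seen in `N` between times `n` and `N₀ + k`; on `C k`, it is in `N`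
  -- at time `ρ ^ 2` after its first return to `B` after time `N₀ + k`
  let A : ℕ → Set Ω := fun k =>
    {ω | ∀ q, (n : ℝ≥0) ≤ r q → r q ≤ ((N₀ + k : ℕ) : ℝ≥0) → W 0 x (r q) ω ∉ N}
  let G : ℕ → Set Ω := fun k => A k ∩ {ω | τ k ω ≠ ⊤}
  let C : ℕ → Set Ω := fun k => {ω | ω ∈ A k ∧ τ k ω ≠ ⊤ ∧ W 0 x ((τ k ω).untopD 0 + ρ ^ 2) ω ∈ N}
  have hA : ∀ k, MeasurableSet[minimalFiltration U P ((N₀ + k : ℕ) : ℝ≥0)] (A k) := fun k => by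
    have : A k = ⋂ (q : ℕ) (_ : (n : ℝ≥0) ≤ r q) (_ : r q ≤ ((N₀ + k : ℕ) : ℝ≥0)),
        (W 0 x (r q) ⁻¹' N)ᶜ := by
      ext ω; simp [A]
    rw [this]
    exact MeasurableSet.iInter fun q => MeasurableSet.iInter fun _ => MeasurableSet.iInter fun hq =>
      (minimalFiltration U P).mono hq _ (h.adapted hx _ Metric.isOpen_ball.measurableSet).compl
  have hτtop : ∀ k ω, τ k ω ≠ ⊤ ↔ ∃ q, ((N₀ + k : ℕ) : ℝ≥0) ≤ r q ∧ W 0 x (r q) ω ∈ B :=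
      fun k ω => by
    have hlt : denseHitTime B ((N₀ + k : ℕ) : ℝ≥0) (fun t => W 0 x t ω) < ⊤
        ↔ ∃ q, ((N₀ + k : ℕ) : ℝ≥0) ≤ r q ∧ W 0 x (r q) ω ∈ B := by
      simp only [denseHitTime_lt_iff, ENNReal.coe_lt_top, true_and]
      rfl
    exact lt_top_iff_ne_top.symm.trans hlt
  have hτm : ∀ k, MeasurableSet {ω | τ k ω ≠ ⊤} := fun k => by
    have : {ω | τ k ω ≠ ⊤} = ⋃ (q : ℕ) (_ : ((N₀ + k : ℕ) : ℝ≥0) ≤ r q), W 0 x (r q) ⁻¹' B := by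
      ext ω
      simp only [mem_ofPred_eq, hτtop, mem_iUnion, mem_preimage, exists_prop]
    rw [this]
    exact MeasurableSet.iUnion fun q => MeasurableSet.iUnion fun _ =>
      h.measurable_path hx _ Metric.isOpen_ball.measurableSet
  have hG : ∀ k, MeasurableSet (G k) := fun k =>
    ((minimalFiltration U P).le _ _ (hA k)).inter (hτm k)
  have hzero : P (⋂ k, G k) = 0 := by
    refine measure_iInter_eq_zero_of_escape (C := C) hG ?_ (fun k ω hω => ⟨hω.1, hω.2.1⟩) hm0 ?_ ?_
    · refine antitone_nat_of_succ_le fun k => ?_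
      have hle : ((N₀ + k : ℕ) : ℝ≥0) ≤ ((N₀ + (k + 1) : ℕ) : ℝ≥0) := Nat.cast_le.2 (by omega)
      rintro ω ⟨ha, hb⟩
      refine ⟨fun q h1 h2 => ha q h1 (h2.trans hle), (hτtop k ω).2 ?_⟩
      obtain ⟨q, h1, h2⟩ := (hτtop (k + 1) ω).1 hb
      exact ⟨q, hle.trans h1, h2⟩
    · intro k
      have hAτ : MeasurableSet[(hτ k).measurableSpace] (A k) := by
        refine IsStoppingTime.measurableSpace_mono (isStoppingTime_const _ _) (hτ k) (hτle k) _ ?_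
        rw [IsStoppingTime.measurableSpace_const]
        exact hA k
      have hsm := h.strong_markov 0 x hx (τ k) (hτ k) (fun ω => zero_le) (A k) hAτ (ρ ^ 2) N
        Metric.isOpen_ball.measurableSet
      change m * P (A k ∩ {ω | τ k ω ≠ ⊤}) ≤
        P {ω | ω ∈ A k ∧ τ k ω ≠ ⊤ ∧ W 0 x ((τ k ω).untopD 0 + ρ ^ 2) ω ∈ N}
      rw [hsm, ← setLIntegral_const]
      refine lintegral_mono_ae ((ae_restrict_iff' (hG k)).2 ?_)
      filter_upwards [h.ae_continuous hx] with ω hω hmem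
      have hne : denseHitTime B ((N₀ + k : ℕ) : ℝ≥0) (fun t => W 0 x t ω) ≠ ⊤ := hmem.2
      have hunt : ((τ k ω).untopD 0 : ℝ≥0)
          = (denseHitTime B ((N₀ + k : ℕ) : ℝ≥0) (fun t => W 0 x t ω)).toNNReal := rfl
      have hle : ((N₀ + k : ℕ) : ℝ≥0) ≤ (τ k ω).untopD 0 := by
        rw [hunt, ← ENNReal.coe_le_coe, ENNReal.coe_toNNReal hne]
        exact le_denseHitTime
      refine hkey _ _ y _ N hc ?_ ?_ ?_ Metric.isOpen_ball.measurableSet ?_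
      · rw [hsq]
        exact hballT.trans (h.monotone ((hT₀N k).trans hle))
      · rw [hsq, hunt]
        have h1 := mem_closure_of_denseHitTime hω hne
        refine Metric.closedBall_subset_ball ?_ (Metric.closure_ball_subset_closedBall h1)
        rw [hρv]
        have := norm_nonneg (y' - y)
        linarith
      · rwa [hsq]
      · rw [hsq, div_mul_cancel₀ _ (by positivity), ENNReal.ofReal_toReal hNtop]
    · intro k
      rw [measure_eq_zero_iff_ae_notMem]
      filter_upwards [h.ae_continuous hx] with ω hω
      rintro ⟨⟨-, hne, hmem⟩, hall⟩
      have hle : ((N₀ + k : ℕ) : ℝ≥0) ≤ (τ k ω).untopD 0 := by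
        have hne' : denseHitTime B ((N₀ + k : ℕ) : ℝ≥0) (fun t => W 0 x t ω) ≠ ⊤ := hne
        change _ ≤ (denseHitTime B ((N₀ + k : ℕ) : ℝ≥0) (fun t => W 0 x t ω)).toNNReal
        rw [← ENNReal.coe_le_coe, ENNReal.coe_toNNReal hne']
        exact le_denseHitTime
      obtain ⟨q, hq, hqN⟩ := exists_denseSeq_mem (a := n) hω Metric.isOpen_ball
        (((hnN k).trans hle).trans_lt (lt_add_of_pos_right _ (pos_iff_ne_zero.2 hc))) hmem
      obtain ⟨j, hj⟩ := exists_nat_ge (r q)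
      exact (mem_iInter.1 hall j).1 q hq (hj.trans (Nat.cast_le.2 (Nat.le_add_left _ _))) hqN
  filter_upwards [measure_eq_zero_iff_ae_notMem.1 hzero, h.ae_continuous hx] with ω hω hcont hvis
  by_contra! hnone
  refine hω (mem_iInter.2 fun k => ⟨fun q hq _ hqN => ?_, (hτtop k ω).2 ?_⟩)
  · exact absurd (mem_ball_iff_norm.1 hqN) (not_lt.2 (hnone _ hq))
  · obtain ⟨t, ht, htB⟩ := hvis (((N₀ + k : ℕ) : ℝ≥0) + 1)
    exact exists_denseSeq_mem hcont Metric.isOpen_ball ((lt_add_one _).trans_le ht)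
      (mem_ball_iff_norm.2 htB)

theorem ae_visitsLate_of_visitsLate [IsProbabilityMeasure P] (h : IsRBMG D U P W L)
    (hx : (0, x) ∈ closure (timeSpace D)) (hexh : ∀ R : ℝ, ∃ t, Metric.ball x R ⊆ D t)
    (y y' : EuclideanSpace ℝ (Fin d)) :
    ∀ᵐ ω ∂P, VisitsLate y (fun t => W 0 x t ω) → VisitsLate y' (fun t => W 0 x t ω) := by
  have hall : ∀ᵐ ω ∂P, ∀ m n : ℕ, (∀ T : ℝ≥0, ∃ t ≥ T, ‖W 0 x t ω - y‖ < 1) →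
      ∃ t ≥ (n : ℝ≥0), ‖W 0 x t ω - y'‖ < 1 / (m + 1) :=
    ae_all_iff.2 fun m => ae_all_iff.2 fun n =>
      h.ae_visits_of_visits hx hexh y y' (by positivity) n
  filter_upwards [hall] with ω hω hv ε hε T
  obtain ⟨n, hn⟩ := exists_nat_ge T
  obtain ⟨m, hm⟩ := exists_nat_one_div_lt hε
  obtain ⟨t, ht, htv⟩ := hω m n (hv 1 one_pos)
  exact ⟨t, hn.trans ht, htv.trans hm⟩

/-- When the domains exhaust the space, up to null sets the recurrence event is the event that the
path visits every neighbourhood of `y` at arbitrarily late times: leaving the ball of radius `1/2`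
is automatic, since the path also comes back close to a point at distance one from `y`. -/
theorem ae_isXYRecurrent_iff [IsProbabilityMeasure P] (h : IsRBMG D U P W L) (hd : 1 ≤ d)
    (hx : (0, x) ∈ closure (timeSpace D)) (hexh : ∀ R : ℝ, ∃ t, Metric.ball x R ⊆ D t)
    (y : EuclideanSpace ℝ (Fin d)) :
    ∀ᵐ ω ∂P, IsXYRecurrent D x y (fun t => W 0 x t ω) ↔ VisitsLate y (fun t => W 0 x t ω) := by
  set e : EuclideanSpace ℝ (Fin d) := EuclideanSpace.single ⟨0, hd⟩ 1
  have he : ‖e‖ = 1 := by simp [e]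
  filter_upwards [h.ae_start hx, h.ae_continuous hx,
    h.ae_visitsLate_of_visitsLate hx hexh y (y + e)] with ω h0 hc hret
  refine ⟨fun hr => hr.visitsLate hc,
    fun hv => isXYRecurrent_of_visitsLate h0 hv (fun T => ?_) hexh⟩
  obtain ⟨t, ht, htv⟩ := hret hv (1 / 2) (by norm_num) T
  refine ⟨t, ht, ?_⟩
  have h1 : ‖e‖ ≤ ‖W 0 x t ω - y‖ + ‖W 0 x t ω - (y + e)‖ := by
    calc ‖e‖ = ‖(W 0 x t ω - y) - (W 0 x t ω - (y + e))‖ := by congr 1; abel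
      _ ≤ _ := norm_sub_le _ _
  change 1 / 2 < ‖W 0 x t ω - y‖
  change ‖W 0 x t ω - (y + e)‖ < 1 / 2 at htv
  linarith

end IsRBMG

/-! ### The Markov property and events of the future -/

namespace IsRBMG

variable {d : ℕ} {Ω : Type*} [MeasurableSpace Ω] {P : Measure Ω}
  {D : ℝ≥0 → Set (EuclideanSpace ℝ (Fin d))} {U : ℝ≥0 → Ω → EuclideanSpace ℝ (Fin d)}
  {W : ℝ≥0 → EuclideanSpace ℝ (Fin d) → ℝ≥0 → Ω → EuclideanSpace ℝ (Fin d)}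
  {L : ℝ≥0 → EuclideanSpace ℝ (Fin d) → ℝ≥0 → Ω → ℝ} {x z : EuclideanSpace ℝ (Fin d)}

/-- The Markov property at a deterministic time. -/
theorem measure_inter_eq_setLIntegral (h : IsRBMG D U P W L) (hx : (0, x) ∈ closure (timeSpace D))
    (t r : ℝ≥0) {A : Set Ω} (hA : MeasurableSet[minimalFiltration U P t] A)
    {B : Set (EuclideanSpace ℝ (Fin d))} (hB : MeasurableSet B) :
    P (A ∩ {ω | W 0 x (t + r) ω ∈ B}) = ∫⁻ ω in A, P {ω' | W t (W 0 x t ω) (t + r) ω' ∈ B} ∂P := by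
  have hA' : MeasurableSet[(isStoppingTime_const (minimalFiltration U P) t).measurableSpace] A := by
    rw [IsStoppingTime.measurableSpace_const]
    exact hA
  have := h.strong_markov 0 x hx (fun _ => (t : WithTop ℝ≥0)) (isStoppingTime_const _ t)
    (fun ω => zero_le) A hA' r B hB
  have htop : (t : WithTop ℝ≥0) ≠ ⊤ := WithTop.coe_ne_top
  have e1 : {ω | ω ∈ A ∧ (t : WithTop ℝ≥0) ≠ ⊤ ∧
      W 0 x ((t : WithTop ℝ≥0).untopD 0 + r) ω ∈ B} = A ∩ {ω | W 0 x (t + r) ω ∈ B} := by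
    ext ω
    exact ⟨fun H => ⟨H.1, H.2.2⟩, fun H => ⟨H.1, htop, H.2⟩⟩
  have e2 : A ∩ {_ω | (t : WithTop ℝ≥0) ≠ ⊤} = A := inter_eq_left.2 fun _ _ => htop
  rw [e1, e2] at this
  exact this

/-- The transition kernel of the process from time `t` to time `t + r`, as a kernel on the whole
space which vanishes outside the closed domain. -/
theorem exists_transition (h : IsRBMG D U P W L) (t r : ℝ≥0) :
    ∃ κ : EuclideanSpace ℝ (Fin d) → Measure (EuclideanSpace ℝ (Fin d)), Measurable κ ∧
      ∀ w, (t, w) ∈ closure (timeSpace D) → ∀ B, MeasurableSet B →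
        κ w B = P {ω | W t w (t + r) ω ∈ B} := by
  classical
  have hmW : ∀ w, (t, w) ∈ closure (timeSpace D) → Measurable (W t w (t + r)) := fun w hw =>
    ((h.solution t w hw).adapted_path (t + r) le_self_add).mono
      ((minimalFiltration U P).le _) le_rfl
  have hval : ∀ w, (t, w) ∈ closure (timeSpace D) → ∀ B, MeasurableSet B →
      (if (t, w) ∈ closure (timeSpace D) then P.map (W t w (t + r)) else 0) B
        = P {ω | W t w (t + r) ω ∈ B} := fun w hw B hB => by
    rw [if_pos hw, Measure.map_apply (hmW w hw) hB]
    rfl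
  refine ⟨fun w => if (t, w) ∈ closure (timeSpace D) then P.map (W t w (t + r)) else 0, ?_, hval⟩
  refine Measure.measurable_of_measurable_coe _ fun B hB => ?_
  have hS : MeasurableSet {w | (t, w) ∈ closure (timeSpace D)} :=
    (isClosed_closure.preimage (by fun_prop : Continuous fun w => (t, w))).measurableSet
  refine measurable_of_restrict_of_restrict_compl hS ?_ ?_
  · have h1 : Measurable fun w : {w | (t, w) ∈ closure (timeSpace D)} =>
        (⟨(t, w), w.2⟩ : closure (timeSpace D)) :=
      Measurable.subtype_mk (measurable_const.prodMk measurable_subtype_coe)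
    convert (h.measurable_transition r B hB).comp h1 using 1
    funext w
    exact hval w w.2 B hB
  · convert measurable_const (a := (0 : ℝ≥0∞)) using 1
    funext w
    have hw : (t, (w : EuclideanSpace ℝ (Fin d))) ∉ closure (timeSpace D) := w.2
    simp [hw]

/-- The Markov property for functions: there is a transition operator `φ ↦ ψ` from time `t` to time
`t + r`, which is the same for all starting points `x`. -/
theorem exists_transition_operator [IsFiniteMeasure P] (h : IsRBMG D U P W L) (t r : ℝ≥0)
    {φ : EuclideanSpace ℝ (Fin d) → ℝ≥0∞} (hφ : Measurable φ) :
    ∃ ψ : EuclideanSpace ℝ (Fin d) → ℝ≥0∞, Measurable ψ ∧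
      ∀ x, (0, x) ∈ closure (timeSpace D) → ∀ g : Ω → ℝ≥0∞, Measurable[minimalFiltration U P t] g →
        ∫⁻ ω, g ω * φ (W 0 x (t + r) ω) ∂P = ∫⁻ ω, g ω * ψ (W 0 x t ω) ∂P := by
  obtain ⟨κ, hκ, hκP⟩ := h.exists_transition t r
  refine ⟨fun w => ∫⁻ v, φ v ∂κ w, (Measure.measurable_lintegral hφ).comp hκ, fun x hx g hg => ?_⟩
  have hF := (minimalFiltration U P).le t
  have hg' : Measurable g := hg.mono hF le_rfl
  have hWt := h.measurable_path hx t
  have hWr := h.measurable_path hx (t + r)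
  have hset : ∀ B, MeasurableSet B →
      ∫⁻ ω in W 0 x (t + r) ⁻¹' B, g ω ∂P = ∫⁻ ω, g ω * κ (W 0 x t ω) B ∂P := by
    intro B hB
    have hκm : Measurable fun ω => κ (W 0 x t ω) B := ((Measure.measurable_coe hB).comp hκ).comp hWt
    have htrim : (P.restrict (W 0 x (t + r) ⁻¹' B)).trim hF
        = (P.withDensity fun ω => κ (W 0 x t ω) B).trim hF := by
      refine @Measure.ext _ (minimalFiltration U P t) _ _ fun A hA => ?_
      rw [trim_measurableSet_eq hF hA, trim_measurableSet_eq hF hA,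
        Measure.restrict_apply (hF _ hA), withDensity_apply _ (hF _ hA)]
      refine (h.measure_inter_eq_setLIntegral hx t r hA hB).trans ?_
      refine lintegral_congr_ae (ae_restrict_of_ae ?_)
      filter_upwards [(h.solution 0 x hx).solves] with ω hω
      exact (hκP _ (hω.mem_closure t zero_le) B hB).symm
    rw [← lintegral_trim hF hg, htrim, lintegral_trim hF hg,
      lintegral_withDensity_eq_lintegral_mul _ hκm hg']
    simp only [Pi.mul_apply, mul_comm]
  have hmeas : (P.withDensity g).map (W 0 x (t + r)) =
      ((P.withDensity g).map (W 0 x t)).bind κ := by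
    refine Measure.ext fun B hB => ?_
    have hκB : Measurable fun w => κ w B := (Measure.measurable_coe hB).comp hκ
    rw [Measure.map_apply hWr hB, withDensity_apply _ (hWr hB), hset B hB,
      Measure.bind_apply hB hκ.aemeasurable, lintegral_map hκB hWt]
    exact (lintegral_withDensity_eq_lintegral_mul P hg' (hκB.comp hWt)).symm
  have hψ : Measurable fun w => ∫⁻ v, φ v ∂κ w := (Measure.measurable_lintegral hφ).comp hκ
  calc ∫⁻ ω, g ω * φ (W 0 x (t + r) ω) ∂P
      = ∫⁻ v, φ v ∂(P.withDensity g).map (W 0 x (t + r)) := by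
        rw [lintegral_map hφ hWr]
        exact (lintegral_withDensity_eq_lintegral_mul P hg' (hφ.comp hWr)).symm
    _ = ∫⁻ w, ∫⁻ v, φ v ∂κ w ∂(P.withDensity g).map (W 0 x t) := by
        rw [hmeas, Measure.lintegral_bind hκ.aemeasurable hφ.aemeasurable]
    _ = ∫⁻ ω, g ω * ∫⁻ v, φ v ∂κ (W 0 x t ω) ∂P := by
        rw [lintegral_map hψ hWt]
        exact lintegral_withDensity_eq_lintegral_mul P hg' (hψ.comp hWt)

/-- Given the past up to time `t`, the conditional probability of a finite-dimensional event after
time `t` is a function `φ` of the position at time `t`, the same for all starting points. -/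
theorem exists_cylinder_density [IsFiniteMeasure P] (h : IsRBMG D U P W L) (I : Finset ℝ≥0)
    {B : ℝ≥0 → Set (EuclideanSpace ℝ (Fin d))} (hB : ∀ u, MeasurableSet (B u)) :
    ∀ t : ℝ≥0, (∀ u ∈ I, t ≤ u) → ∃ φ : EuclideanSpace ℝ (Fin d) → ℝ≥0∞, Measurable φ ∧
      ∀ x, (0, x) ∈ closure (timeSpace D) → ∀ g : Ω → ℝ≥0∞, Measurable[minimalFiltration U P t] g →
        ∫⁻ ω in {ω | ∀ u ∈ I, W 0 x u ω ∈ B u}, g ω ∂P = ∫⁻ ω, g ω * φ (W 0 x t ω) ∂P := by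
  induction I using Finset.induction_on_min with
  | empty =>
    intro t _
    exact ⟨fun _ => 1, measurable_const, fun x hx g hg => by simp⟩
  | insert a s has ih =>
    intro t ht
    obtain ⟨φ, hφ, hφP⟩ := ih a fun u hu => (has u hu).le
    have hta : t ≤ a := ht a (Finset.mem_insert_self a s)
    obtain ⟨ψ, hψ, hψP⟩ := h.exists_transition_operator t (a - t) (hφ.indicator (hB a))
    refine ⟨ψ, hψ, fun x hx g hg => ?_⟩
    rw [← hψP x hx g hg, add_tsub_cancel_of_le hta]
    have hga : Measurable[minimalFiltration U P a] ((W 0 x a ⁻¹' B a).indicator g) :=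
      Measurable.indicator (m := minimalFiltration U P a)
        (hg.mono ((minimalFiltration U P).mono hta) le_rfl) (h.adapted hx a (hB a))
    have hset : {ω | ∀ u ∈ insert a s, W 0 x u ω ∈ B u}
        = (W 0 x a ⁻¹' B a) ∩ {ω | ∀ u ∈ s, W 0 x u ω ∈ B u} := by
      ext ω; simp
    rw [hset, ← setLIntegral_indicator (h.measurable_path hx a (hB a)), hφP x hx _ hga]
    refine lintegral_congr fun ω => ?_
    by_cases hω : W 0 x a ω ∈ B a
    · rw [indicator_of_mem (show ω ∈ W 0 x a ⁻¹' B a from hω), indicator_of_mem hω]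
    · rw [indicator_of_notMem (show ω ∉ W 0 x a ⁻¹' B a from hω), indicator_of_notMem hω, zero_mul,
        mul_zero]

/-- If on the event `A`, which belongs to the past of time `t`, the law of the position at time `t`
of the process from `x` is absolutely continuous with respect to that of the process from `z`, then
an event of the future of time `t` that is null for the process from `z` is null on `A` for the
process from `x`. -/
theorem measure_future_eq_zero [IsFiniteMeasure P] (h : IsRBMG D U P W L)
    (hx : (0, x) ∈ closure (timeSpace D)) (hz : (0, z) ∈ closure (timeSpace D)) (t : ℝ≥0)
    {A : Set Ω} (hA : MeasurableSet[minimalFiltration U P t] A)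
    (hac : ∀ N, MeasurableSet N → P {ω | W 0 z t ω ∈ N} = 0 → P (A ∩ {ω | W 0 x t ω ∈ N}) = 0)
    {Γ : Set (ℝ≥0 → EuclideanSpace ℝ (Fin d))} (hΓ : MeasurableSet Γ)
    (hz0 : P {ω | (fun r => W 0 z (t + r) ω) ∈ Γ} = 0) :
    P (A ∩ {ω | (fun r => W 0 x (t + r) ω) ∈ Γ}) = 0 := by
  have hF := (minimalFiltration U P).le t
  have hAm : MeasurableSet A := hF _ hA
  have hxm := h.measurable_path hx
  have hzm := h.measurable_path hz
  have hxp : Measurable fun ω r => W 0 x (t + r) ω := measurable_pi_lambda _ fun r => hxm _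
  have hzp : Measurable fun ω r => W 0 z (t + r) ω := measurable_pi_lambda _ fun r => hzm _
  set νx := (P.restrict A).map (W 0 x t) with hνx
  set νz := P.map (W 0 z t) with hνz
  have hacν : νx ≪ νz := by
    refine Measure.AbsolutelyContinuous.mk fun N hN hN0 => ?_
    rw [hνz, Measure.map_apply (hzm t) hN] at hN0
    rw [hνx, Measure.map_apply (hxm t) hN, Measure.restrict_apply (hxm t hN), inter_comm]
    exact hac N hN hN0
  set f := νx.rnDeriv νz
  have hf : Measurable f := Measure.measurable_rnDeriv _ _
  have hνf : νz.withDensity f = νx := Measure.withDensity_rnDeriv_eq νx νz hacν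
  have hpath : (P.restrict A).map (fun ω r => W 0 x (t + r) ω)
      = (P.withDensity fun ω => f (W 0 z t ω)).map (fun ω r => W 0 z (t + r) ω) := by
    refine measure_pi_ext_of_squareCylinders fun I B hB => ?_
    classical
    obtain ⟨φ, hφ, hφP⟩ := h.exists_cylinder_density (I.image (t + ·)) (B := fun v => B (v - t))
      (fun u => hB _) t (by simp)
    have hcyl : MeasurableSet ((I : Set ℝ≥0).pi B) :=
      MeasurableSet.pi I.countable_toSet fun i _ => hB i
    have hset : ∀ v, (fun ω r => W 0 v (t + r) ω) ⁻¹' ((I : Set ℝ≥0).pi B)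
        = {ω | ∀ u ∈ I.image (t + ·), W 0 v u ω ∈ B (u - t)} := fun v => by
      ext ω; simp [Set.mem_pi]
    rw [Measure.map_apply hxp hcyl, Measure.map_apply hzp hcyl,
      Measure.restrict_apply (hxp hcyl), withDensity_apply _ (hzp hcyl), hset, hset,
      hφP z hz (fun ω => f (W 0 z t ω)) (hf.comp (h.adapted hz t))]
    have hone : Measurable[minimalFiltration U P t] (1 : Ω → ℝ≥0∞) :=
      @measurable_const _ _ _ (minimalFiltration U P t) 1
    have h1 := hφP x hx (A.indicator 1) (hone.indicator hA)
    rw [lintegral_indicator_one hAm, Measure.restrict_apply hAm, inter_comm] at h1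
    rw [h1]
    calc ∫⁻ ω, A.indicator 1 ω * φ (W 0 x t ω) ∂P = ∫⁻ v, φ v ∂νx := by
          rw [hνx, lintegral_map hφ (hxm t), ← lintegral_indicator hAm]
          refine lintegral_congr fun ω => ?_
          by_cases hω : ω ∈ A <;> simp [hω]
      _ = ∫⁻ v, f v * φ v ∂νz := by
          rw [← hνf, lintegral_withDensity_eq_lintegral_mul _ hf hφ]
          rfl
      _ = _ := lintegral_map (hf.mul hφ) (hzm t)
  have hΓeq : (P.restrict A).map (fun ω r => W 0 x (t + r) ω) Γ
      = (P.withDensity fun ω => f (W 0 z t ω)).map (fun ω r => W 0 z (t + r) ω) Γ := by rw [hpath]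
  rw [Measure.map_apply hxp hΓ, Measure.map_apply hzp hΓ, Measure.restrict_apply (hxp hΓ),
    inter_comm] at hΓeq
  change P (A ∩ (fun ω r => W 0 x (t + r) ω) ⁻¹' Γ) = 0
  rw [hΓeq]
  exact withDensity_absolutelyContinuous _ _ hz0

end IsRBMG

/-! ### Comparison of the laws from two starting points -/

/-- Half the volume of the Euclidean ball of radius `1 / 2`: relative to the scale `√c`, the volume
of targets that fill at least half of a ball of radius `√c / 2`. -/
noncomputable def halfBallVolume (d : ℕ) : ℝ :=
  (volume (Metric.ball (0 : EuclideanSpace ℝ (Fin d)) 1)).toReal / 2 ^ d / 2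

theorem halfBallVolume_pos (d : ℕ) : 0 < halfBallVolume d := by
  have : 0 < (volume (Metric.ball (0 : EuclideanSpace ℝ (Fin d)) 1)).toReal :=
    ENNReal.toReal_pos (Metric.measure_ball_pos _ _ one_pos).ne' measure_ball_lt_top.ne
  unfold halfBallVolume
  positivity

/-- Half a ball of radius `r`, as a proportion of the scale `2 * r`. -/
theorem ofReal_halfBallVolume_mul {d : ℕ} (q : EuclideanSpace ℝ (Fin d)) {r : ℝ} (hr : 0 < r) :
    ENNReal.ofReal (halfBallVolume d * (2 * r) ^ d) = volume (Metric.ball q r) / 2 := by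
  have hfin : volume (Metric.ball (0 : EuclideanSpace ℝ (Fin d)) 1) ≠ ⊤ := measure_ball_lt_top.ne
  have heq : halfBallVolume d * (2 * r) ^ d
      = r ^ d * (volume (Metric.ball (0 : EuclideanSpace ℝ (Fin d)) 1)).toReal / 2 := by
    rw [halfBallVolume, mul_pow]
    field_simp
  rw [heq, ENNReal.ofReal_div_of_pos two_pos, ENNReal.ofReal_ofNat,
    ENNReal.ofReal_mul (by positivity), ENNReal.ofReal_toReal hfin,
    Measure.addHaar_ball_of_pos _ _ hr, finrank_euclideanSpace_fin]

namespace IsRBMG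

variable {d : ℕ} {Ω : Type*} [MeasurableSpace Ω] {P : Measure Ω}
  {D : ℝ≥0 → Set (EuclideanSpace ℝ (Fin d))} {U : ℝ≥0 → Ω → EuclideanSpace ℝ (Fin d)}
  {W : ℝ≥0 → EuclideanSpace ℝ (Fin d) → ℝ≥0 → Ω → EuclideanSpace ℝ (Fin d)}
  {L : ℝ≥0 → EuclideanSpace ℝ (Fin d) → ℝ≥0 → Ω → ℝ} {x z : EuclideanSpace ℝ (Fin d)}

/-- A lower bound for the probability of being in `N`, by the Markov property at time `t` on the
event of being in `B`. -/
theorem mul_measure_le_of_forall (h : IsRBMG D U P W L) (hz : (0, z) ∈ closure (timeSpace D))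
    (t r : ℝ≥0) {B N : Set (EuclideanSpace ℝ (Fin d))} (hB : MeasurableSet B)
    (hN : MeasurableSet N) {m : ℝ≥0∞} (hm : ∀ w ∈ B, m ≤ P {ω | W t w (t + r) ω ∈ N}) :
    m * P {ω | W 0 z t ω ∈ B} ≤ P {ω | W 0 z (t + r) ω ∈ N} := by
  calc m * P {ω | W 0 z t ω ∈ B}
      = ∫⁻ _ω in W 0 z t ⁻¹' B, m ∂P := (setLIntegral_const _ _).symm
    _ ≤ ∫⁻ ω in W 0 z t ⁻¹' B, P {ω' | W t (W 0 z t ω) (t + r) ω' ∈ N} ∂P :=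
        setLIntegral_mono' (h.measurable_path hz t hB) fun ω hω => hm _ hω
    _ = P (W 0 z t ⁻¹' B ∩ {ω | W 0 z (t + r) ω ∈ N}) :=
        (h.measure_inter_eq_setLIntegral hz t r (h.adapted hz t hB) hN).symm
    _ ≤ _ := measure_mono inter_subset_right

/-- If the process is close to `p` at time `t` with positive probability, then it is close to `q` at
time `t + s` with positive probability, when the segment from `p` to `q` has a neighbourhood in the
initial domain: the process can follow a chain of small balls along the segment, and time steps that
are short compared with `s` leave room for any `s > 0`. -/
theorem measure_mem_ball_ne_zero_of_segment [IsProbabilityMeasure P] (h : IsRBMG D U P W L)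
    (hz : (0, z) ∈ closure (timeSpace D)) {p q : EuclideanSpace ℝ (Fin d)} {ρ : ℝ}
    (hball : Metric.ball p (2 * ρ) ⊆ D 0) (hq : ‖q - p‖ < ρ) {t : ℝ≥0}
    (ht : ∀ η : ℝ, 0 < η → P {ω | W 0 z t ω ∈ Metric.ball p η} ≠ 0) {s : ℝ≥0} (hs : s ≠ 0) {η : ℝ}
    (hη : 0 < η) : P {ω | W 0 z (t + s) ω ∈ Metric.ball q η} ≠ 0 := by
  obtain ⟨K, hK, m, hm0, hkey⟩ := h.exists_le_measure_mem (halfBallVolume_pos d)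
  have hs0 : (0 : ℝ) < s := NNReal.coe_pos.2 (pos_iff_ne_zero.2 hs)
  have hρ : 0 < ρ := (norm_nonneg _).trans_lt hq
  -- the segment from `p` to `q` is covered in `n` steps of duration `s / n`
  have hlim : Tendsto (fun n : ℕ => √((s : ℝ) / n)) atTop (𝓝 0) := by
    have := (tendsto_const_div_atTop_nhds_zero_nat (s : ℝ)).sqrt
    rwa [Real.sqrt_zero] at this
  obtain ⟨n, hn1, hnρ, hnη, hnq⟩ : ∃ n : ℕ, 1 ≤ n ∧ √((s : ℝ) / n) < ρ / K ∧
      √((s : ℝ) / n) < η ∧ (2 * ‖q - p‖) ^ 2 / s ≤ n :=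
    ((eventually_ge_atTop 1).and ((hlim.eventually_lt_const (by positivity)).and
      ((hlim.eventually_lt_const hη).and
        (tendsto_natCast_atTop_atTop.eventually_ge_atTop ((2 * ‖q - p‖) ^ 2 / s))))).exists
  have hn0 : (0 : ℝ) < n := by exact_mod_cast hn1
  set c : ℝ≥0 := s / n with hc
  have hcv : (c : ℝ) = s / n := by rw [hc, NNReal.coe_div, NNReal.coe_natCast]
  have hcpos : (0 : ℝ) < c := by rw [hcv]; positivity
  have hc0 : c ≠ 0 := (NNReal.coe_pos.1 hcpos).ne'
  rw [← hcv] at hnρ hnη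
  have hsq : 0 < √(c : ℝ) := Real.sqrt_pos.2 hcpos
  have hstep : ‖q - p‖ / n ≤ √(c : ℝ) / 2 := by
    rw [le_div_iff₀ two_pos]
    refine Real.le_sqrt_of_sq_le ?_
    rw [hcv, div_mul_eq_mul_div, div_pow, div_le_div_iff₀ (by positivity) hn0]
    rw [div_le_iff₀ hs0] at hnq
    nlinarith
  let a : ℕ → EuclideanSpace ℝ (Fin d) := fun i => p + ((i : ℝ) / n) • (q - p)
  have hchain : ∀ i : ℕ, i ≤ n →
      P {ω | W 0 z (t + i * c) ω ∈ Metric.ball (a i) (√(c : ℝ))} ≠ 0 := by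
    intro i
    induction i with
    | zero =>
      intro _
      simpa [a] using ht _ hsq
    | succ i ih =>
      intro hi
      have hprev := ih (by omega)
      have hai : ‖a i - p‖ < ρ := by
        have h1 : a i - p = ((i : ℝ) / n) • (q - p) := by simp [a]
        have h2 : (i : ℝ) / n ≤ 1 := by
          rw [div_le_one hn0]
          exact_mod_cast (show i ≤ n by omega)
        rw [h1, norm_smul, Real.norm_of_nonneg (by positivity)]
        exact (mul_le_of_le_one_left (norm_nonneg _) h2).trans_lt hq
      have hstep' : dist (a (i + 1)) (a i) ≤ √(c : ℝ) / 2 := by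
        have h1 : a (i + 1) - a i = (1 / (n : ℝ)) • (q - p) := by
          simp only [a]
          rw [add_sub_add_left_eq_sub, ← sub_smul]
          congr 1
          push_cast
          ring
        rw [dist_eq_norm, h1, norm_smul, Real.norm_of_nonneg (by positivity), one_div,
          ← div_eq_inv_mul]
        exact hstep
      have hD : Metric.ball (a i) (K * √(c : ℝ)) ⊆ D 0 := by
        refine (Metric.ball_subset_ball' ?_).trans hball
        rw [dist_eq_norm]
        rw [lt_div_iff₀ (by linarith)] at hnρ
        linarith
      have hle := h.mul_measure_le_of_forall hz (t + i * c) c (m := m)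
        (B := Metric.ball (a i) (√(c : ℝ))) (N := Metric.ball (a (i + 1)) (√(c : ℝ) / 2))
        Metric.isOpen_ball.measurableSet Metric.isOpen_ball.measurableSet fun w hw => by
          refine hkey _ c (a i) w _ hc0 (hD.trans (h.monotone zero_le)) hw ?_
            Metric.isOpen_ball.measurableSet ?_
          · exact Metric.ball_subset_ball' (by linarith)
          · have h1 := ofReal_halfBallVolume_mul (a (i + 1)) (half_pos hsq)
            rw [mul_div_cancel₀ _ two_ne_zero] at h1
            rw [h1]
            exact ENNReal.half_le_self
      have htime : t + ((i + 1 : ℕ) : ℝ≥0) * c = t + i * c + c := by push_cast; ring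
      rw [htime]
      intro h0
      refine mul_ne_zero hm0 hprev (le_antisymm (hle.trans ?_) zero_le)
      rw [← h0]
      refine measure_mono fun ω hω => ?_
      exact Metric.ball_subset_ball (by linarith) hω
  have hfinal := hchain n le_rfl
  have haq : a n = q := by simp [a, div_self hn0.ne']
  have htime : (n : ℝ≥0) * c = s := by
    rw [hc, mul_div_cancel₀]
    exact_mod_cast hn0.ne'
  rw [haq, htime] at hfinal
  refine fun h0 => hfinal (measure_mono_null (fun ω hω => ?_) h0)
  exact Metric.ball_subset_ball hnη.le (mem_ofPred.1 hω)

/-- At every positive time, the process charges every ball centred in the initial domain: the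
centres that are charged at all positive times form a set that is open and relatively closed in the
connected set `D 0`. -/
theorem measure_mem_ball_ne_zero [IsProbabilityMeasure P] (h : IsRBMG D U P W L)
    (hopen : IsOpen (D 0)) (hconn : IsConnected (D 0)) (hz : z ∈ D 0)
    {p : EuclideanSpace ℝ (Fin d)} (hp : p ∈ D 0) {s : ℝ≥0} (hs : s ≠ 0) {η : ℝ} (hη : 0 < η) :
    P {ω | W 0 z s ω ∈ Metric.ball p η} ≠ 0 := by
  have hz' : (0, z) ∈ closure (timeSpace D) := subset_closure hz
  let S : Set (EuclideanSpace ℝ (Fin d)) := {p | p ∈ D 0 ∧ ∀ s : ℝ≥0, s ≠ 0 → ∀ η : ℝ, 0 < η →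
    P {ω | W 0 z s ω ∈ Metric.ball p η} ≠ 0}
  have hspread : ∀ p ∈ S, ∀ ρ : ℝ, Metric.ball p (2 * ρ) ⊆ D 0 → ∀ q ∈ Metric.ball p ρ, q ∈ S := by
    intro p hp ρ hball q hq
    have hρ : 0 < ρ := Metric.pos_of_mem_ball hq
    refine ⟨hball (Metric.ball_subset_ball (by linarith) hq), fun s hs η hη => ?_⟩
    have hs2 : s / 2 ≠ 0 := div_ne_zero hs two_ne_zero
    have := h.measure_mem_ball_ne_zero_of_segment hz' hball (mem_ball_iff_norm.1 hq)
      (hp.2 _ hs2) hs2 hη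
    rwa [add_halves] at this
  have hzS : z ∈ S := by
    refine ⟨hz, fun s hs η hη => ?_⟩
    obtain ⟨R, hR, hball⟩ := Metric.isOpen_iff.1 hopen z hz
    have := h.measure_mem_ball_ne_zero_of_segment hz' (p := z) (q := z) (ρ := R / 2) (t := 0)
      (by rwa [mul_div_cancel₀ _ two_ne_zero]) (by simpa using hR) (fun η hη h0 => ?_) hs hη
    · rwa [zero_add] at this
    · obtain ⟨ω, h1, h2⟩ := ((h.ae_start hz').and (measure_eq_zero_iff_ae_notMem.1 h0)).exists
      refine h2 ?_
      change W 0 z 0 ω ∈ Metric.ball z η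
      rw [h1]
      exact Metric.mem_ball_self hη
  have hSopen : IsOpen S := by
    refine Metric.isOpen_iff.2 fun p hp => ?_
    obtain ⟨R, hR, hball⟩ := Metric.isOpen_iff.1 hopen p hp.1
    exact ⟨R / 2, half_pos hR, hspread p hp (R / 2) (by rwa [mul_div_cancel₀ _ two_ne_zero])⟩
  have hsub : D 0 ⊆ S := by
    refine hconn.isPreconnected.subset_of_closure_inter_subset hSopen ⟨z, hz, hzS⟩ ?_
    rintro q ⟨hqS, hqD⟩
    obtain ⟨R, hR, hball⟩ := Metric.isOpen_iff.1 hopen q hqD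
    obtain ⟨p, hpS, hqp⟩ := Metric.mem_closure_iff.1 hqS (R / 3) (by positivity)
    refine hspread p hpS (R / 3) ((Metric.ball_subset_ball' ?_).trans hball) q hqp
    rw [dist_comm]
    linarith
  exact (hsub hp).2 s hs η hη

/-- Inside the initial domain, the law of the process at a positive time charges every set of
positive volume. Around a Lebesgue density point of the set, the process is in a small ball with
positive probability, and from there it reaches the set within a time comparable to the square of
the radius. -/
theorem measure_mem_ne_zero_of_volume [IsProbabilityMeasure P] (h : IsRBMG D U P W L)
    (hopen : IsOpen (D 0)) (hconn : IsConnected (D 0)) (hz : z ∈ D 0)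
    {N : Set (EuclideanSpace ℝ (Fin d))} (hN : MeasurableSet N) (hND : N ⊆ D 0)
    (hvol : volume N ≠ 0) {t : ℝ≥0} (ht : t ≠ 0) : P {ω | W 0 z t ω ∈ N} ≠ 0 := by
  have hz' : (0, z) ∈ closure (timeSpace D) := subset_closure hz
  obtain ⟨K, hK, m, hm0, hkey⟩ := h.exists_le_measure_mem (halfBallVolume_pos d)
  have hne : (ae (volume.restrict N)).NeBot := ae_neBot.2 (Measure.restrict_eq_zero.not.2 hvol)
  -- `p` is a density point of `N` that belongs to `N`
  obtain ⟨p, hpN, hp⟩ := ((ae_restrict_mem hN).and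
    (Besicovitch.ae_tendsto_measure_inter_div volume N)).exists
  obtain ⟨R, hR, hball⟩ := Metric.isOpen_iff.1 hopen p (hND hpN)
  have ht0 : (0 : ℝ) < t := NNReal.coe_pos.2 (pos_iff_ne_zero.2 ht)
  have hhalf : ∀ᶠ r in 𝓝[>] (0 : ℝ),
      2⁻¹ < volume (N ∩ Metric.closedBall p r) / volume (Metric.closedBall p r) :=
    hp.eventually_const_lt ENNReal.one_half_lt_one
  have hsmall : ∀ᶠ r in 𝓝[>] (0 : ℝ), K * (2 * r) < R ∧ (2 * r) ^ 2 < t := by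
    refine nhdsWithin_le_nhds ?_
    have h1 : Tendsto (fun r : ℝ => K * (2 * r)) (𝓝 0) (𝓝 (K * (2 * 0))) :=
      Continuous.tendsto (by fun_prop) 0
    have h2 : Tendsto (fun r : ℝ => (2 * r) ^ 2) (𝓝 0) (𝓝 ((2 * 0) ^ 2)) :=
      Continuous.tendsto (by fun_prop) 0
    exact (h1.eventually_lt_const (by simpa using hR)).and
      (h2.eventually_lt_const (by simpa using ht0))
  obtain ⟨r, ⟨hr, hKr, hrt⟩, hr0⟩ := ((hhalf.and hsmall).and self_mem_nhdsWithin).exists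
  replace hr0 : 0 < r := hr0
  lift r to ℝ≥0 using hr0.le
  set c : ℝ≥0 := (2 * r) ^ 2 with hc
  have hsq : √(c : ℝ) = 2 * r := by
    rw [hc, NNReal.coe_pow, Real.sqrt_sq (NNReal.coe_nonneg _), NNReal.coe_mul]
    rfl
  have hc0 : c ≠ 0 := pow_ne_zero _ (mul_ne_zero two_ne_zero (NNReal.coe_pos.1 hr0).ne')
  have hct : c < t := by
    rw [← NNReal.coe_lt_coe, hc]
    push_cast
    exact hrt
  have htime : t - c + c = t := tsub_add_cancel_of_le hct.le
  have hle := h.mul_measure_le_of_forall hz' (t - c) c (m := m) (B := Metric.ball p (√(c : ℝ)))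
    (N := N ∩ Metric.closedBall p r) Metric.isOpen_ball.measurableSet
    (hN.inter Metric.isClosed_closedBall.measurableSet) fun w hw => by
      refine hkey _ c p w _ hc0 ?_ hw ?_ (hN.inter Metric.isClosed_closedBall.measurableSet) ?_
      · rw [hsq]
        exact ((Metric.ball_subset_ball hKr.le).trans hball).trans (h.monotone zero_le)
      · rw [hsq]
        exact inter_subset_right.trans (Metric.closedBall_subset_ball (by linarith))
      · rw [hsq, ofReal_halfBallVolume_mul p hr0]
        refine (ENNReal.div_le_div_right (measure_mono Metric.ball_subset_closedBall) 2).trans ?_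
        rw [ENNReal.lt_div_iff_mul_lt (Or.inl (Metric.measure_closedBall_pos _ _ hr0).ne')
          (Or.inl measure_closedBall_lt_top.ne)] at hr
        rw [ENNReal.div_eq_inv_mul]
        exact hr.le
  rw [htime] at hle
  have hpos := h.measure_mem_ball_ne_zero hopen hconn hz (hND hpN) (tsub_pos_of_lt hct).ne'
    (hsq ▸ (by positivity : (0 : ℝ) < 2 * r) : 0 < √(c : ℝ))
  intro h0
  refine mul_ne_zero hm0 hpos (le_antisymm (hle.trans ?_) zero_le)
  rw [← h0]
  exact measure_mono fun ω hω => hω.1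

/-- A path event that is invariant under time shifts of continuous paths and null for the process
from one point of the initial domain is null for the process from every such point. -/
theorem measure_eq_zero_of_shift_invariant [IsProbabilityMeasure P] (h : IsRBMG D U P W L)
    (hopen : IsOpen (D 0)) (hconn : IsConnected (D 0)) (hx : x ∈ D 0) (hz : z ∈ D 0)
    {Γ : Set (ℝ≥0 → EuclideanSpace ℝ (Fin d))} (hΓ : MeasurableSet Γ)
    (hinv : ∀ w : ℝ≥0 → EuclideanSpace ℝ (Fin d), Continuous w → ∀ t : ℝ≥0,
      w ∈ Γ ↔ (fun r => w (t + r)) ∈ Γ)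
    (hz0 : P {ω | (fun t => W 0 z t ω) ∈ Γ} = 0) : P {ω | (fun t => W 0 x t ω) ∈ Γ} = 0 := by
  have hx' : (0, x) ∈ closure (timeSpace D) := subset_closure hx
  have hz' : (0, z) ∈ closure (timeSpace D) := subset_closure hz
  obtain ⟨R, hR, hball⟩ := Metric.isOpen_iff.1 hopen x hx
  let r := TopologicalSpace.denseSeq ℝ≥0
  let T : ℕ → ℝ≥0 := fun n => 1 / (n + 1)
  have hT : ∀ n, T n ≠ 0 := fun n => by positivity
  -- `A n`: the path from `x` stays in a small ball up to time `T n`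
  let A : ℕ → Set Ω := fun n => {ω | ∀ q, r q ≤ T n → W 0 x (r q) ω ∈ Metric.closedBall x (R / 2)}
  have hA : ∀ n, MeasurableSet[minimalFiltration U P (T n)] (A n) := fun n => by
    have : A n = ⋂ (q : ℕ) (_ : r q ≤ T n), W 0 x (r q) ⁻¹' Metric.closedBall x (R / 2) := by
      ext ω; simp [A]
    rw [this]
    exact MeasurableSet.iInter fun q => MeasurableSet.iInter fun hq =>
      (minimalFiltration U P).mono hq _ (h.adapted hx' _ Metric.isClosed_closedBall.measurableSet)
  have hnull : ∀ n, P (A n ∩ {ω | (fun u => W 0 x (T n + u) ω) ∈ Γ}) = 0 := by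
    intro n
    refine h.measure_future_eq_zero hx' hz' (T n) (hA n) (fun N hN hN0 => ?_) hΓ ?_
    · have hvol : volume (N ∩ D 0) = 0 := by
        by_contra hvol
        exact h.measure_mem_ne_zero_of_volume hopen hconn hz (hN.inter hopen.measurableSet)
          inter_subset_right hvol (hT n) (measure_mono_null (fun ω hω => hω.1) hN0)
      have hincr := h.brownian.measure_increment_mem_eq_zero 0 (hT n) x
        (hN.inter hopen.measurableSet) hvol
      rw [measure_eq_zero_iff_ae_notMem] at hincr ⊢
      filter_upwards [hincr, (h.solution 0 x hx').solves, h.ae_continuous hx'] with ω h1 h2 h3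
      rintro ⟨hAω, hNω⟩
      have hin : ∀ u ≤ T n, W 0 x u ω ∈ Metric.ball x R := by
        intro u hu
        have hcl : u ∈ closure (Iio (T n) ∩ range r) := by
          have hd := closure_minimal
            ((TopologicalSpace.denseRange_denseSeq ℝ≥0).open_subset_closure_inter
            (isOpen_Iio (a := T n))) isClosed_closure
          rw [closure_Iio' ⟨0, mem_Iio.2 (pos_iff_ne_zero.2 (hT n))⟩] at hd
          exact hd hu
        refine Metric.closedBall_subset_ball (half_lt_self hR)
          (closure_minimal ?_ (Metric.isClosed_closedBall.preimage h3) hcl)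
        rintro - ⟨hv, q, rfl⟩
        exact hAω q (le_of_lt hv)
      have heq := h2.eq_of_forall_mem_ball h.monotone hball (zero_le (a := T n))
        fun u hu => hin u hu.2
      refine h1 ?_
      rw [zero_add, ← heq]
      exact ⟨hNω, hball (hin _ le_rfl)⟩
    · rw [measure_eq_zero_iff_ae_notMem] at hz0 ⊢
      filter_upwards [hz0, h.ae_continuous hz'] with ω h1 h2 h3
      exact h1 ((hinv _ h2 (T n)).2 h3)
  rw [measure_eq_zero_iff_ae_notMem]
  filter_upwards [ae_all_iff.2 fun n => measure_eq_zero_iff_ae_notMem.1 (hnull n),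
    h.ae_continuous hx', h.ae_start hx'] with ω h1 h2 h3 h4
  have hnhds : ∀ᶠ u in 𝓝 (0 : ℝ≥0), W 0 x u ω ∈ Metric.closedBall x (R / 2) := by
    have := h2.tendsto 0
    simp only [h3] at this
    exact this (Metric.closedBall_mem_nhds x (half_pos hR))
  obtain ⟨b, hb, hbsub⟩ := exists_Ico_subset_of_mem_nhds hnhds ⟨1, zero_lt_one⟩
  obtain ⟨n, hn⟩ := exists_nat_one_div_lt hb
  refine h1 n ⟨fun q hq => hbsub ⟨zero_le, hq.trans_lt hn⟩, (hinv _ h2 (T n)).1 h4⟩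

end IsRBMG

/-! ### The probability of recurrence -/

/-- The event `VisitsLate y`, read off along a countable dense set of times. It agrees with
`VisitsLate y` on continuous paths, and is measurable. -/
def denseVisits {d : ℕ} (y : EuclideanSpace ℝ (Fin d)) : Set (ℝ≥0 → EuclideanSpace ℝ (Fin d)) :=
  {w | ∀ n m : ℕ, ∃ q : ℕ, (n : ℝ≥0) ≤ TopologicalSpace.denseSeq ℝ≥0 q ∧
    ‖w (TopologicalSpace.denseSeq ℝ≥0 q) - y‖ < 1 / (m + 1)}

theorem measurableSet_denseVisits {d : ℕ} (y : EuclideanSpace ℝ (Fin d)) :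
    MeasurableSet (denseVisits y) := by
  simp only [denseVisits, ofPred_forall, ofPred_exists]
  refine MeasurableSet.iInter fun n => MeasurableSet.iInter fun m =>
    MeasurableSet.iUnion fun q => ?_
  have hm : Measurable fun w : ℝ≥0 → EuclideanSpace ℝ (Fin d) =>
      ‖w (TopologicalSpace.denseSeq ℝ≥0 q) - y‖ :=
    ((measurable_pi_apply (X := fun _ : ℝ≥0 => EuclideanSpace ℝ (Fin d))
      (TopologicalSpace.denseSeq ℝ≥0 q)).sub_const y).norm
  exact (MeasurableSet.const ((n : ℝ≥0) ≤ TopologicalSpace.denseSeq ℝ≥0 q)).inter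
    (show MeasurableSet {w : ℝ≥0 → EuclideanSpace ℝ (Fin d) |
      ‖w (TopologicalSpace.denseSeq ℝ≥0 q) - y‖ < 1 / (m + 1)} from
      measurableSet_lt hm measurable_const)

theorem visitsLate_iff_shift_mem_denseVisits {d : ℕ} (y : EuclideanSpace ℝ (Fin d))
    {w : ℝ≥0 → EuclideanSpace ℝ (Fin d)} (hw : Continuous w) (t : ℝ≥0) :
    VisitsLate y w ↔ (fun r => w (t + r)) ∈ denseVisits y :=
  visitsLate_iff_denseSeq hw t

theorem visitsLate_iff_mem_denseVisits {d : ℕ} (y : EuclideanSpace ℝ (Fin d))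
    {w : ℝ≥0 → EuclideanSpace ℝ (Fin d)} (hw : Continuous w) :
    VisitsLate y w ↔ w ∈ denseVisits y := by
  simpa using visitsLate_iff_shift_mem_denseVisits y hw 0

/-- If the domains do not exhaust the space by balls around `x`, then some `σ⁽⁰⁾` is infinite, and
no path is recurrent. -/
theorem measure_isXYRecurrent_eq_zero_of_not_exhaust {d : ℕ} {Ω : Type*} [MeasurableSpace Ω]
    {P : Measure Ω} {D : ℝ≥0 → Set (EuclideanSpace ℝ (Fin d))}
    {w : ℝ≥0 → Ω → EuclideanSpace ℝ (Fin d)} {x : EuclideanSpace ℝ (Fin d)}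
    (hexh : ¬∀ R : ℝ, ∃ t, Metric.ball x R ⊆ D t) (y : EuclideanSpace ℝ (Fin d)) :
    P {ω | IsXYRecurrent D x y (fun t => w t ω)} = 0 := by
  convert measure_empty (μ := P)
  exact eq_empty_iff_forall_notMem.2 fun ω hω => hexh fun R =>
    IsXYRecurrent.exists_ball_subset (mem_ofPred.1 hω) R

namespace IsRBMG

variable {d : ℕ} {Ω : Type*} [MeasurableSpace Ω] {P : Measure Ω} [IsProbabilityMeasure P]
  {D : ℝ≥0 → Set (EuclideanSpace ℝ (Fin d))} {U : ℝ≥0 → Ω → EuclideanSpace ℝ (Fin d)}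
  {W : ℝ≥0 → EuclideanSpace ℝ (Fin d) → ℝ≥0 → Ω → EuclideanSpace ℝ (Fin d)}
  {L : ℝ≥0 → EuclideanSpace ℝ (Fin d) → ℝ≥0 → Ω → ℝ} {x z : EuclideanSpace ℝ (Fin d)}

theorem measure_isXYRecurrent_eq_denseVisits (h : IsRBMG D U P W L) (hd : 1 ≤ d) (hx : x ∈ D 0)
    (hexh : ∀ R : ℝ, ∃ t, Metric.ball x R ⊆ D t) (y : EuclideanSpace ℝ (Fin d)) :
    P {ω | IsXYRecurrent D x y (fun t => W 0 x t ω)}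
      = P {ω | (fun t => W 0 x t ω) ∈ denseVisits y} := by
  have hx' : (0, x) ∈ closure (timeSpace D) := subset_closure hx
  refine measure_congr ?_
  filter_upwards [h.ae_isXYRecurrent_iff hd hx' hexh y, h.ae_continuous hx'] with ω h1 h2
  exact propext (h1.trans (visitsLate_iff_mem_denseVisits y h2))

theorem measure_isXYRecurrent_eq (h : IsRBMG D U P W L) (hd : 1 ≤ d) (hx : x ∈ D 0)
    (y y' : EuclideanSpace ℝ (Fin d)) :
    P {ω | IsXYRecurrent D x y (fun t => W 0 x t ω)}
      = P {ω | IsXYRecurrent D x y' (fun t => W 0 x t ω)} := by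
  have hx' : (0, x) ∈ closure (timeSpace D) := subset_closure hx
  by_cases hexh : ∀ R : ℝ, ∃ t, Metric.ball x R ⊆ D t
  · refine measure_congr ?_
    filter_upwards [h.ae_isXYRecurrent_iff hd hx' hexh y, h.ae_isXYRecurrent_iff hd hx' hexh y',
      h.ae_visitsLate_of_visitsLate hx' hexh y y', h.ae_visitsLate_of_visitsLate hx' hexh y' y]
      with ω h1 h2 h3 h4
    exact propext (h1.trans ((Iff.intro h3 h4).trans h2.symm))
  · rw [measure_isXYRecurrent_eq_zero_of_not_exhaust hexh,
      measure_isXYRecurrent_eq_zero_of_not_exhaust hexh]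

theorem measure_isXYRecurrent_eq_of_zero_or_one (h : IsRBMG D U P W L) (hd : 1 ≤ d)
    (hopen : IsOpen (D 0)) (hconn : IsConnected (D 0)) (hx : x ∈ D 0) (hz : z ∈ D 0)
    (y : EuclideanSpace ℝ (Fin d))
    (hzy : P {ω | IsXYRecurrent D z y (fun t => W 0 z t ω)} = 0 ∨
      P {ω | IsXYRecurrent D z y (fun t => W 0 z t ω)} = 1) :
    P {ω | IsXYRecurrent D x y (fun t => W 0 x t ω)}
      = P {ω | IsXYRecurrent D z y (fun t => W 0 z t ω)} := by
  have hexh_of : ∀ {a b : EuclideanSpace ℝ (Fin d)}, (∀ R : ℝ, ∃ t, Metric.ball a R ⊆ D t) →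
      ∀ R : ℝ, ∃ t, Metric.ball b R ⊆ D t := fun {a b} H R =>
    (H (R + dist b a)).imp fun t ht => (Metric.ball_subset_ball' le_rfl).trans ht
  by_cases hexh : ∀ R : ℝ, ∃ t, Metric.ball z R ⊆ D t
  · have hexhx : ∀ R : ℝ, ∃ t, Metric.ball x R ⊆ D t := hexh_of hexh
    rw [h.measure_isXYRecurrent_eq_denseVisits hd hz hexh] at hzy ⊢
    rw [h.measure_isXYRecurrent_eq_denseVisits hd hx hexhx]
    have hinv : ∀ w : ℝ≥0 → EuclideanSpace ℝ (Fin d), Continuous w → ∀ t : ℝ≥0,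
        w ∈ denseVisits y ↔ (fun r => w (t + r)) ∈ denseVisits y := fun w hw t =>
      (visitsLate_iff_mem_denseVisits y hw).symm.trans (visitsLate_iff_shift_mem_denseVisits y hw t)
    have hmeas : ∀ a ∈ D 0, MeasurableSet {ω | (fun t => W 0 a t ω) ∈ denseVisits y} :=
      fun a ha => (measurable_pi_lambda _ fun t => h.measurable_path (subset_closure ha) t)
        (measurableSet_denseVisits y)
    rcases hzy with h0 | h1
    · rw [h0]
      exact h.measure_eq_zero_of_shift_invariant hopen hconn hx hz (measurableSet_denseVisits y)
        hinv h0
    · rw [h1]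
      refine (prob_compl_eq_zero_iff (hmeas x hx)).1 ?_
      exact h.measure_eq_zero_of_shift_invariant hopen hconn hx hz
        (measurableSet_denseVisits y).compl (fun w hw t => not_congr (hinv w hw t))
        ((prob_compl_eq_zero_iff (hmeas z hz)).2 h1)
  · rw [measure_isXYRecurrent_eq_zero_of_not_exhaust hexh,
      measure_isXYRecurrent_eq_zero_of_not_exhaust fun H => hexh (hexh_of H)]

end IsRBMG

theorem proposition3 (d : ℕ) (hd : 1 ≤ d) :
    -- simple random walk on growing connected subgraphs of the lattice
    (∀ (Ω : Type*) [MeasurableSpace Ω] (D : ℕ → (latticeGraph d).Subgraph)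
        (X : ℕ → Ω → (Fin d → ℤ)) (P : (Fin d → ℤ) → Measure Ω),
      Monotone D → (∀ t, (D t).Connected) → (⋃ t, (D t).verts) = univ →
      (∀ x ∈ (D 0).verts, IsSRW D x X (P x)) →
      (∀ x ∈ (D 0).verts, ∀ y y' : Fin d → ℤ,
        P x {ω | IsWalkRecurrent x y (fun t => X t ω)}
          = P x {ω | IsWalkRecurrent x y' (fun t => X t ω)}) ∧
      (∀ z ∈ (D 0).verts, ∀ y : Fin d → ℤ,
        P z {ω | IsWalkRecurrent z y (fun t => X t ω)} = 0 →
        ∀ x ∈ (D 0).verts, Even (l1Norm (x - z)) →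
          P x {ω | IsWalkRecurrent x y (fun t => X t ω)} = 0)) ∧
    -- reflected Brownian motion on growing domains
    (∀ (Ω : Type*) [MeasurableSpace Ω] (P : Measure Ω) [IsProbabilityMeasure P]
        (D : ℝ≥0 → Set (EuclideanSpace ℝ (Fin d)))
        (U : ℝ≥0 → Ω → EuclideanSpace ℝ (Fin d))
        (W : ℝ≥0 → EuclideanSpace ℝ (Fin d) → ℝ≥0 → Ω → EuclideanSpace ℝ (Fin d))
        (L : ℝ≥0 → EuclideanSpace ℝ (Fin d) → ℝ≥0 → Ω → ℝ),
      IsRBMG D U P W L → IsOpen (D 0) → IsConnected (D 0) → (⋃ t, D t) = univ →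
      (∀ x ∈ D 0, ∀ y y' : EuclideanSpace ℝ (Fin d),
        P {ω | IsXYRecurrent D x y (fun t => W 0 x t ω)}
          = P {ω | IsXYRecurrent D x y' (fun t => W 0 x t ω)}) ∧
      (∀ z ∈ D 0, ∀ y : EuclideanSpace ℝ (Fin d),
        (P {ω | IsXYRecurrent D z y (fun t => W 0 z t ω)} = 0 ∨
          P {ω | IsXYRecurrent D z y (fun t => W 0 z t ω)} = 1) →
        ∀ x ∈ D 0,
          P {ω | IsXYRecurrent D x y (fun t => W 0 x t ω)}
            = P {ω | IsXYRecurrent D z y (fun t => W 0 z t ω)})) := by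
  refine ⟨fun Ω _ D X P hD hconn huniv hP => ⟨fun x hx y y' => ?_, fun z hz y hzy x hx heven => ?_⟩,
    fun Ω _ P _ D U W L h hopen hconn _ => ⟨fun x hx y y' => ?_, fun z hz y hzy x hx => ?_⟩⟩
  · exact (hP x hx).measure_isWalkRecurrent_eq hD hconn huniv y y'
  · by_cases hxz : x = z
    · rwa [hxz]
    · exact (hP x hx).measure_isWalkRecurrent_eq_zero (hP z hz) hD hconn huniv hx hz hxz heven hzy
  · exact h.measure_isXYRecurrent_eq hd hx y y'
  · exact h.measure_isXYRecurrent_eq_of_zero_or_one hd hopen hconn hx hz y hzy
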